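/- Let $n,m\ge 0$ be integers, let $r\ge 0$, $L\ge 0$ and let $f:\mathbb R^n\times\mathbb R^m\to\mathbb R^n$ be locally Lipschitz with $$|f(x,u)-f(y,u)|\le L|x-y|,\qquad |f(x,u)|\le L|x|+L|u|\qquad (x,y\in\mathbb R^n,\ u\in\mathbb R^m),$$ where $|\cdot|$ is the Euclidean norm; on $C^0([-r,0];\mathbb R^m)$ put $\|u\|_r=\sup_{-r\le\theta\le 0}|u(\theta)|$, and write $(T_r(t)u)(\theta)=u(t+\theta)$ for $\theta\in[-r,0]$. Let $k\in\mathbb R^{n\times m}$, with transpose $k'$. A function $\sigma:[0,\infty)^2\to[0,\infty)$ is of class $KL$ if it is continuous, $\sigma(\cdot,t)$ is strictly increasing with $\sigma(0,t)=0$ for each $t\ge0$, and $\sigma(s,\cdot)$ is nonincreasing with limit $0$ at infinity for each $s\ge0$. For measurable, locally essentially bounded $v:[0,\infty)\to\mathbb R^m$ and $x_0\in\mathbb R^n$ consider the solution $x$ of $\dot x(t)=f(x(t),k'x(t)+v(t))$, $x(0)=x_0$, and the two hypotheses: (a) there are $\sigma\in KL$ and $\gamma\ge0$ such that $|x(t)|\le\max\{\sigma(|x_0|,t),\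 \gamma\sup_{0\le\tau\le t}|v(\tau)|\}$ for all such $x_0,v$ and all $t\ge0$; (b) there are $M,\omega>0$ and $\gamma\ge0$ such that $|x(t)|\le\max\{Me^{-\omega t}|x_0|,\ \gamma\sup_{0\le\tau\le t}e^{-\omega(t-\tau)}|v(\tau)|\}$ for all such $x_0,v$ and all $t\ge0$. Let $q\ge1$ be an integer with $Lr<q$ and put $T=r/q$. For $w:[0,T]\to\mathbb R^m$ continuous, let $(P_{w}y)(t)=y(0)+\int_0^t f(y(\tau),w(\tau))\,d\tau$ for continuous $y:[0,T]\to\mathbb R^n$, and for an integer $l\ge1$ and $x\in\mathbb R^n$ let $Q^l_{w}x$ be the value at time $T$ of the $l$-th iterate of $P_w$ applied to the constant function $x$. For $x\in\mathbb R^n$ and $u\in C^0([-r,0];\mathbb R^m)$ define $$\Phi_{l,q}(x,u)=Q^l_{u_q}\cdots Q^l_{u_1}x,\qquad u_i(s)=u(s+(i-1)T-r)\quad(0\le s\le T,\ 1\le i\le q).$$ Let $\mu>0$ and consider the closed loop $$\dot x(t)=f(x(t),u(t-r)),\qquad \dot u(t)=k'f\big(\Phi_{l,q}(x(t),T_r(t)u),u(t)\big)-\mu\big(u(t)-k'\Phi_{l,q}(x(t),T_r(t)u)\big),\qquad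 t\ge0, \tag{1}$$ with $x(0)=x_0$, $T_r(0)u=u_0$. 1. If (a) holds, then for all sufficiently large $l$ there is $\tilde\sigma\in KL$ such that for every $(x_0,u_0)\in\mathbb R^n\times C^0([-r,0];\mathbb R^m)$ the system (1) has a unique solution; it exists for all $t\ge0$ and satisfies $|x(t)|+|u(t)|\le\tilde\sigma(|x_0|+\|u_0\|_r,t)$ for all $t\ge0$. 2. If (b) holds, then for all sufficiently large $l$ there are $\tilde M,\tilde\omega>0$ such that for every $(x_0,u_0)\in\mathbb R^n\times C^0([-r,0];\mathbb R^m)$ the system (1) has a unique solution; it exists for all $t\ge0$ and satisfies $|x(t)|+|u(t)|\le\tilde Me^{-\tilde\omega t}(|x_0|+\|u_0\|_r)$ for all $t\ge0$. "Sufficiently large" means $l\ge l_0$, where $l_0$ may depend on all the data above, including $\mu$, but not on $(x_0,u_0)$. -/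

import Mathlib

open MeasureTheory Set Filter Topology
open scoped Matrix ENNReal

namespace DelayPredictor

/-- Class `KL`: `σ : [0,∞) × [0,∞) → [0,∞)` is continuous, `σ(·, t)` is strictly increasing and
vanishes at `0` for every `t`, and `σ(s, ·)` is nonincreasing and tends to `0` for every `s`.
Only the values at nonnegative arguments matter; nonnegativity follows from `zero` and `strictMono`. -/
structure IsKL (σ : ℝ → ℝ → ℝ) : Prop where
  continuousOn : ContinuousOn (fun p : ℝ × ℝ => σ p.1 p.2) (Ici 0 ×ˢ Ici 0)
  zero : ∀ t, 0 ≤ t → σ 0 t = 0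
  strictMono : ∀ t, 0 ≤ t → StrictMonoOn (fun s => σ s t) (Ici 0)
  antitone : ∀ s, 0 ≤ s → AntitoneOn (fun t => σ s t) (Ici 0)
  tendsto : ∀ s, 0 ≤ s → Tendsto (fun t => σ s t) atTop (𝓝 0)

variable {n m : ℕ}

/-- The linear feedback `x ↦ k' x`, with `k'` the transpose of `k ∈ ℝ^{n × m}`. -/
noncomputable def linFeedback (k : Matrix (Fin n) (Fin m) ℝ) (x : EuclideanSpace ℝ (Fin n)) :
    EuclideanSpace ℝ (Fin m) :=
  WithLp.toLp 2 (kᵀ *ᵥ x.ofLp)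

/-- The class of inputs `v : [0,∞) → ℝ^m` that are measurable and locally essentially bounded
(the values of `v` at negative times are irrelevant). -/
def IsInput (v : ℝ → EuclideanSpace ℝ (Fin m)) : Prop :=
  ∀ t : ℝ, MemLp v ∞ (volume.restrict (Icc 0 t))

/-- `x` is the (Carathéodory) solution on `[0,∞)` of `ẋ = f(x, k'x + v)`, `x(0) = x₀`, in integral
form. For continuous `f` and an input `v` the integrand is always integrable. -/
structure IsPerturbedSolution
    (f : EuclideanSpace ℝ (Fin n) → EuclideanSpace ℝ (Fin m) → EuclideanSpace ℝ (Fin n))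
    (k : Matrix (Fin n) (Fin m) ℝ) (x₀ : EuclideanSpace ℝ (Fin n))
    (v : ℝ → EuclideanSpace ℝ (Fin m)) (x : ℝ → EuclideanSpace ℝ (Fin n)) : Prop where
  continuousOn : ContinuousOn x (Ici 0)
  integral_eq : ∀ t, 0 ≤ t → x t = x₀ + ∫ s in (0 : ℝ)..t, f (x s) (linFeedback k (x s) + v s)

/-- Input-to-state stability, with linear gain, of `ẋ = f(x, k'x + v)` from the input `v`:
`|x(t)| ≤ max {σ(|x₀|, t), γ sup_{0 ≤ τ ≤ t} |v(τ)|}`.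
The supremum is expressed through its upper bounds `B`, so that nothing is claimed when it is
infinite. -/
def ISSLinearGain
    (f : EuclideanSpace ℝ (Fin n) → EuclideanSpace ℝ (Fin m) → EuclideanSpace ℝ (Fin n))
    (k : Matrix (Fin n) (Fin m) ℝ) : Prop :=
  ∃ σ : ℝ → ℝ → ℝ, IsKL σ ∧ ∃ γ : ℝ, 0 ≤ γ ∧
    ∀ (x₀ : EuclideanSpace ℝ (Fin n)) (v : ℝ → EuclideanSpace ℝ (Fin m))
      (x : ℝ → EuclideanSpace ℝ (Fin n)), IsInput v → IsPerturbedSolution f k x₀ v x →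
      ∀ t, 0 ≤ t → ∀ B : ℝ, (∀ τ ∈ Icc (0 : ℝ) t, ‖v τ‖ ≤ B) →
        ‖x t‖ ≤ max (σ ‖x₀‖ t) (γ * B)

/-- The exponential version of the previous estimate:
`|x(t)| ≤ max {M exp(-ωt) |x₀|, γ sup_{0 ≤ τ ≤ t} exp(-ω(t-τ)) |v(τ)|}`. -/
def ISSExponential
    (f : EuclideanSpace ℝ (Fin n) → EuclideanSpace ℝ (Fin m) → EuclideanSpace ℝ (Fin n))
    (k : Matrix (Fin n) (Fin m) ℝ) : Prop :=
  ∃ M ω γ : ℝ, 0 < M ∧ 0 < ω ∧ 0 ≤ γ ∧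
    ∀ (x₀ : EuclideanSpace ℝ (Fin n)) (v : ℝ → EuclideanSpace ℝ (Fin m))
      (x : ℝ → EuclideanSpace ℝ (Fin n)), IsInput v → IsPerturbedSolution f k x₀ v x →
      ∀ t, 0 ≤ t → ∀ B : ℝ, (∀ τ ∈ Icc (0 : ℝ) t, Real.exp (-ω * (t - τ)) * ‖v τ‖ ≤ B) →
        ‖x t‖ ≤ max (M * Real.exp (-ω * t) * ‖x₀‖) (γ * B)

/-- The Picard operator `(P_u x)(t) = x(0) + ∫₀ᵗ f(x(τ), u(τ)) dτ`. -/
noncomputable def picardOp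
    (f : EuclideanSpace ℝ (Fin n) → EuclideanSpace ℝ (Fin m) → EuclideanSpace ℝ (Fin n))
    (u : ℝ → EuclideanSpace ℝ (Fin m)) (x : ℝ → EuclideanSpace ℝ (Fin n)) :
    ℝ → EuclideanSpace ℝ (Fin n) :=
  fun t => x 0 + ∫ τ in (0 : ℝ)..t, f (x τ) (u τ)

/-- `Q^l_{T,u} x₀`: the value at time `T` of the `l`-th Picard iterate that starts from the
constant function `x₀`. -/
noncomputable def picardEnd
    (f : EuclideanSpace ℝ (Fin n) → EuclideanSpace ℝ (Fin m) → EuclideanSpace ℝ (Fin n))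
    (l : ℕ) (T : ℝ) (u : ℝ → EuclideanSpace ℝ (Fin m)) (x₀ : EuclideanSpace ℝ (Fin n)) :
    EuclideanSpace ℝ (Fin n) :=
  ((picardOp f u)^[l] (fun _ => x₀)) T

/-- `Q^l_{T,u_i} ⋯ Q^l_{T,u_1} x`, with `u_j(s) = u(s + (j-1)T)`. -/
noncomputable def picardSteps
    (f : EuclideanSpace ℝ (Fin n) → EuclideanSpace ℝ (Fin m) → EuclideanSpace ℝ (Fin n))
    (l : ℕ) (T : ℝ) (u : ℝ → EuclideanSpace ℝ (Fin m)) (x : EuclideanSpace ℝ (Fin n)) :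
    ℕ → EuclideanSpace ℝ (Fin n)
  | 0 => x
  | i + 1 => picardEnd f l T (fun s => u (s + i * T)) (picardSteps f l T u x i)

/-- The approximate predictor `Φ_{l,q}(x, u) = P_{l,q}^{δ_{-r}u} x`, where `T = r/q`,
`P_{l,q}^w = Q^l_{T,w_q} ⋯ Q^l_{T,w_1}` and `(δ_{-r}u)(s) = u(s - r)`.
Only the values of `u` on `[-r, 0]` are used. -/
noncomputable def predictor
    (f : EuclideanSpace ℝ (Fin n) → EuclideanSpace ℝ (Fin m) → EuclideanSpace ℝ (Fin n))
    (r : ℝ) (l q : ℕ) (x : EuclideanSpace ℝ (Fin n)) (u : ℝ → EuclideanSpace ℝ (Fin m)) :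
    EuclideanSpace ℝ (Fin n) :=
  picardSteps f l (r / q) (fun s => u (s - r)) x q

/-- The history `T_r(t)u`, i.e. `θ ↦ u(t + θ)`, to be read for `θ ∈ [-r, 0]`. -/
def history (u : ℝ → EuclideanSpace ℝ (Fin m)) (t : ℝ) : ℝ → EuclideanSpace ℝ (Fin m) :=
  fun θ => u (t + θ)

/-- `(x, u)` solves, on the time interval `I` with left end point `0 ∈ I`, the closed loop
`ẋ(t) = f(x(t), u(t-r))`,
`u̇(t) = k'f(Φ_{l,q}(x(t), T_r(t)u), u(t)) - μ (u(t) - k'Φ_{l,q}(x(t), T_r(t)u))`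
with `x(0) = x₀` and `T_r(0)u = u₀`. Derivatives are two-sided inside `I` and right derivatives
at `0`; continuity of `x` on `I` and of `u` on `[-r,0] ∪ I` follows. -/
structure IsClosedLoopSolution
    (f : EuclideanSpace ℝ (Fin n) → EuclideanSpace ℝ (Fin m) → EuclideanSpace ℝ (Fin n))
    (k : Matrix (Fin n) (Fin m) ℝ) (r μ : ℝ) (l q : ℕ) (I : Set ℝ)
    (x₀ : EuclideanSpace ℝ (Fin n)) (u₀ : C(Icc (-r) 0, EuclideanSpace ℝ (Fin m)))
    (x : ℝ → EuclideanSpace ℝ (Fin n)) (u : ℝ → EuclideanSpace ℝ (Fin m)) : Prop where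
  x_init : x 0 = x₀
  u_init : ∀ θ : Icc (-r) 0, u θ = u₀ θ
  x_deriv : ∀ t ∈ I, HasDerivWithinAt x (f (x t) (u (t - r))) I t
  u_deriv : ∀ t ∈ I, HasDerivWithinAt u
    (linFeedback k (f (predictor f r l q (x t) (history u t)) (u t))
      - μ • (u t - linFeedback k (predictor f r l q (x t) (history u t)))) I t

/-- For all initial data `(x₀, u₀) ∈ ℝⁿ × C⁰([-r,0]; ℝᵐ)` the closed loop has a solution on `[0,∞)`,
every solution on an interval `[0,b)` is a restriction of it, and
`|x(t)| + |u(t)| ≤ σ(|x₀| + ‖u₀‖_r, t)` for all `t ≥ 0`. -/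
def ClosedLoopEstimate
    (f : EuclideanSpace ℝ (Fin n) → EuclideanSpace ℝ (Fin m) → EuclideanSpace ℝ (Fin n))
    (k : Matrix (Fin n) (Fin m) ℝ) (r μ : ℝ) (l q : ℕ) (σ : ℝ → ℝ → ℝ) : Prop :=
  ∀ (x₀ : EuclideanSpace ℝ (Fin n)) (u₀ : C(Icc (-r) 0, EuclideanSpace ℝ (Fin m))),
    ∃ (x : ℝ → EuclideanSpace ℝ (Fin n)) (u : ℝ → EuclideanSpace ℝ (Fin m)),
      IsClosedLoopSolution f k r μ l q (Ici 0) x₀ u₀ x u ∧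
      (∀ (b : ℝ) (y : ℝ → EuclideanSpace ℝ (Fin n)) (w : ℝ → EuclideanSpace ℝ (Fin m)), 0 < b →
        IsClosedLoopSolution f k r μ l q (Ico 0 b) x₀ u₀ y w →
          EqOn y x (Ico 0 b) ∧ EqOn w u (Ico 0 b)) ∧
      ∀ t, 0 ≤ t → ‖x t‖ + ‖u t‖ ≤ σ (‖x₀‖ + ‖u₀‖) t

end DelayPredictor

/-! Everything turns on the deviation `w(t) = u(t) - k'x(t+r)` of the control from the feedback at
the exact prediction. Since `x(t+r)` has derivative `f(x(t+r), u(t))`, the shifted state solves `ẋ =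
f(x, k'x + w)`, so hypothesis (a) or (b) bounds it in terms of `w`. With `Φ` the approximate
predictor along the trajectory, the control law gives `ẇ = -μw + k'(f(Φ,u) - f(x(t+r),u)) + μk'(Φ -
x(t+r))`, so `w` decays up to a forcing proportional to the prediction error.

On each of the `q` windows of length `T = r/q` the Picard operator contracts with ratio `LT < 1`.
The prediction error is therefore at most `c (LT)^l` times the supremum of `|x|` over `[t, t+r]`,
with `c` independent of `l` (`exists_norm_predictor_sub_le`). It matters that this bound involves
the state alone: the loop between `x` and `w` then has a gain from `x` to `w` that tends to zero as
`l` grows, and for large `l` it beats the fixed gain `γ` from `w` to `x`.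

A weighted small-gain argument (`smallGain_le`) turns this into bounds on `x` and `w`. Weighted by a
small exponential rate, it is already the exponential estimate under (b). Under (a) the unweighted
version gives a bound by a class `K` function. The loop then halves any common bound on `x` and `w`
after a time depending on that bound only (`exists_halving_time`); iteration gives uniform
attraction, and `exists_isKL_majorant` merges boundedness and attraction into one `KL` function.

Well-posedness is independent of stability. For fixed `l` the right-hand side is a causal functional
of the path, of linear growth and Lipschitz on bounded sets, so successive approximations converge
on the whole half-line. -/

namespace DelayPredictor

/-! ### The Picard predictor: causality, continuity, growth, Lipschitz bounds and error. -/

section Picard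

variable {n m : ℕ}
  {f : EuclideanSpace ℝ (Fin n) → EuclideanSpace ℝ (Fin m) → EuclideanSpace ℝ (Fin n)}

theorem continuous_picardOp (hf : Continuous fun p : _ × _ => f p.1 p.2)
    {u : ℝ → EuclideanSpace ℝ (Fin m)} {z : ℝ → EuclideanSpace ℝ (Fin n)}
    (hu : Continuous u) (hz : Continuous z) : Continuous (picardOp f u z) :=
  continuous_const.add (intervalIntegral.continuous_primitive
    (fun a b => (hf.comp (hz.prodMk hu)).intervalIntegrable a b) 0)

theorem continuous_picardIter (hf : Continuous fun p : _ × _ => f p.1 p.2)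
    {u : ℝ → EuclideanSpace ℝ (Fin m)} (hu : Continuous u) (x : EuclideanSpace ℝ (Fin n)) (l : ℕ) :
    Continuous ((picardOp f u)^[l] fun _ => x) := by
  induction l with
  | zero => exact continuous_const
  | succ l ih =>
    rw [Function.iterate_succ_apply']
    exact continuous_picardOp hf hu ih

theorem picardIter_zero (u : ℝ → EuclideanSpace ℝ (Fin m)) (x : EuclideanSpace ℝ (Fin n)) (l : ℕ) :
    ((picardOp f u)^[l] fun _ => x) 0 = x := by
  induction l with
  | zero => rfl
  | succ l ih =>
    rw [Function.iterate_succ_apply']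
    simp [picardOp, ih]

theorem picardIter_succ (u : ℝ → EuclideanSpace ℝ (Fin m)) (x : EuclideanSpace ℝ (Fin n)) (l : ℕ)
    (t : ℝ) : ((picardOp f u)^[l + 1] fun _ => x) t =
      x + ∫ τ in (0 : ℝ)..t, f (((picardOp f u)^[l] fun _ => x) τ) (u τ) := by
  rw [Function.iterate_succ_apply']
  simp [picardOp, picardIter_zero]

theorem picardIter_congr {T : ℝ} {u u' : ℝ → EuclideanSpace ℝ (Fin m)}
    (h : ∀ s ∈ Icc 0 T, u s = u' s) (x : EuclideanSpace ℝ (Fin n)) (l : ℕ) :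
    ∀ t ∈ Icc 0 T, ((picardOp f u)^[l] fun _ => x) t = ((picardOp f u')^[l] fun _ => x) t := by
  induction l with
  | zero => exact fun _ _ => rfl
  | succ l ih =>
    intro t ht
    rw [picardIter_succ, picardIter_succ]
    congr 1
    refine intervalIntegral.integral_congr fun τ hτ => ?_
    rw [uIcc_of_le ht.1] at hτ
    have hτ' : τ ∈ Icc 0 T := ⟨hτ.1, hτ.2.trans ht.2⟩
    simp only [ih τ hτ', h τ hτ']

/-- Step `i` reads the input only on the window from `iT` to `(i+1)T`. This locality is what lets
histories be replaced by globally continuous extensions later. -/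
theorem picardSteps_congr {T : ℝ} (hT : 0 ≤ T) {u u' : ℝ → EuclideanSpace ℝ (Fin m)} {N : ℕ}
    (h : ∀ s ∈ Icc 0 (N * T), u s = u' s) (x : EuclideanSpace ℝ (Fin n)) (l : ℕ) :
    ∀ i ≤ N, picardSteps f l T u x i = picardSteps f l T u' x i := by
  intro i
  induction i with
  | zero => exact fun _ => rfl
  | succ i ih =>
    intro hi
    simp only [picardSteps, picardEnd, ih (by omega)]
    refine picardIter_congr (T := T) (fun s hs => h _ ?_) _ l T ⟨hT, le_rfl⟩
    have h1 : ((i : ℝ) + 1) * T ≤ N * T :=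
      mul_le_mul_of_nonneg_right (by exact_mod_cast hi) hT
    have h2 : 0 ≤ (i : ℝ) * T := by positivity
    exact ⟨by linarith [hs.1], by linarith [hs.2]⟩

theorem predictor_congr {r : ℝ} (hr : 0 ≤ r) {q : ℕ} (hq : 0 < q)
    {u u' : ℝ → EuclideanSpace ℝ (Fin m)} (h : ∀ θ ∈ Icc (-r) 0, u θ = u' θ)
    (x : EuclideanSpace ℝ (Fin n)) (l : ℕ) : predictor f r l q x u = predictor f r l q x u' := by
  refine picardSteps_congr (by positivity) (N := q) (fun s hs => h _ ?_) x l q le_rfl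
  rw [mul_div_cancel₀ _ (by positivity)] at hs
  exact ⟨by linarith [hs.1], by linarith [hs.2]⟩

/-- Joint continuity in the parameter and in time is what the induction needs, since each window
evaluates an iterate started from a parameter-dependent point. It serves to make the closed-loop
right-hand side continuous in time. -/
theorem continuous_picardIter_param (hf : Continuous fun p : _ × _ => f p.1 p.2)
    {x : ℝ → EuclideanSpace ℝ (Fin n)} (hx : Continuous x)
    {U : ℝ → ℝ → EuclideanSpace ℝ (Fin m)} (hU : Continuous fun p : ℝ × ℝ => U p.1 p.2) (l : ℕ) :
    Continuous fun p : ℝ × ℝ => ((picardOp f (U p.1))^[l] fun _ => x p.1) p.2 := by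
  induction l with
  | zero => exact hx.comp continuous_fst
  | succ l ih =>
    simp only [picardIter_succ]
    refine (hx.comp continuous_fst).add ?_
    exact intervalIntegral.continuous_parametric_primitive_of_continuous
      (f := fun a τ => f (((picardOp f (U a))^[l] fun _ => x a) τ) (U a τ)) (hf.comp (ih.prodMk hU))

theorem continuous_picardSteps_param (hf : Continuous fun p : _ × _ => f p.1 p.2)
    {x : ℝ → EuclideanSpace ℝ (Fin n)} (hx : Continuous x)
    {U : ℝ → ℝ → EuclideanSpace ℝ (Fin m)} (hU : Continuous fun p : ℝ × ℝ => U p.1 p.2)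
    (l : ℕ) (T : ℝ) (i : ℕ) : Continuous fun t => picardSteps f l T (U t) (x t) i := by
  induction i with
  | zero => exact hx
  | succ i ih =>
    have := continuous_picardIter_param hf ih (U := fun t s => U t (s + i * T))
      (hU.comp (continuous_fst.prodMk (continuous_snd.add continuous_const))) l
    exact this.comp (continuous_id.prodMk (continuous_const (y := T)))

theorem continuous_predictor_history (hf : Continuous fun p : _ × _ => f p.1 p.2)
    {x : ℝ → EuclideanSpace ℝ (Fin n)} (hx : Continuous x) {u : ℝ → EuclideanSpace ℝ (Fin m)}
    (hu : Continuous u) (r : ℝ) (l q : ℕ) :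
    Continuous fun t => predictor f r l q (x t) (history u t) := by
  refine continuous_picardSteps_param hf hx (U := fun t s => history u t (s - r)) ?_ l (r / q) q
  exact hu.comp (continuous_fst.add (continuous_snd.sub continuous_const))

theorem norm_integral_le_mul {E : Type*} [NormedAddCommGroup E] [NormedSpace ℝ E] {g : ℝ → E}
    {T C t : ℝ} (hg : ∀ s ∈ Icc 0 T, ‖g s‖ ≤ C) (ht : t ∈ Icc 0 T) :
    ‖∫ s in (0 : ℝ)..t, g s‖ ≤ C * T := by
  have hC : 0 ≤ C := (norm_nonneg _).trans (hg t ht)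
  have h := intervalIntegral.norm_integral_le_of_norm_le_const (a := 0) (b := t) (f := g) (C := C)
    fun s hs => by
      rw [uIoc_of_le ht.1] at hs
      exact hg s ⟨hs.1.le, hs.2.trans ht.2⟩
  rw [sub_zero, abs_of_nonneg ht.1] at h
  exact h.trans (mul_le_mul_of_nonneg_left ht.2 hC)

/-- The constant depends on `l`, which is harmless: this bound feeds only the well-posedness
argument, where `l` is fixed. The stability argument uses the error bound instead. -/
theorem exists_norm_picardIter_le {L : ℝ} (hL : 0 ≤ L)
    (hgrowth : ∀ x u, ‖f x u‖ ≤ L * ‖x‖ + L * ‖u‖) {T : ℝ} (hT : 0 ≤ T) (l : ℕ) :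
    ∃ C, 0 ≤ C ∧ ∀ (x : EuclideanSpace ℝ (Fin n)) (u : ℝ → EuclideanSpace ℝ (Fin m)) (S : ℝ),
      ‖x‖ ≤ S → (∀ s ∈ Icc 0 T, ‖u s‖ ≤ S) →
      ∀ t ∈ Icc 0 T, ‖((picardOp f u)^[l] fun _ => x) t‖ ≤ C * S := by
  induction l with
  | zero => exact ⟨1, zero_le_one, fun x u S hx _ t _ => by simpa using hx⟩
  | succ l ih =>
    obtain ⟨C, hC, h⟩ := ih
    refine ⟨1 + (L * C + L) * T, by positivity, fun x u S hx hu t ht => ?_⟩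
    rw [picardIter_succ]
    have := norm_integral_le_mul (C := (L * C + L) * S)
      (g := fun τ => f (((picardOp f u)^[l] fun _ => x) τ) (u τ)) (fun s hs => ?_) ht
    · refine (norm_add_le _ _).trans ?_
      linarith
    · refine (hgrowth _ _).trans ?_
      have h1 := mul_le_mul_of_nonneg_left (h x u S hx hu s hs) hL
      have h2 := mul_le_mul_of_nonneg_left (hu s hs) hL
      linarith

/-- `f` is Lipschitz on bounded sets, jointly in both arguments. -/
def LipOnBounded (f : EuclideanSpace ℝ (Fin n) → EuclideanSpace ℝ (Fin m) →
    EuclideanSpace ℝ (Fin n)) : Prop :=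
  ∀ R : ℝ, ∃ K, 0 ≤ K ∧ ∀ x x' u u' D, ‖x‖ ≤ R → ‖x'‖ ≤ R → ‖u‖ ≤ R → ‖u'‖ ≤ R →
    ‖x - x'‖ ≤ D → ‖u - u'‖ ≤ D → ‖f x u - f x' u'‖ ≤ K * D

/-- Closed balls are compact in finite dimension, and a locally Lipschitz map is Lipschitz on
compact sets. -/
theorem lipOnBounded_of_locallyLipschitz
    (hf : LocallyLipschitz fun p : EuclideanSpace ℝ (Fin n) × EuclideanSpace ℝ (Fin m) =>
      f p.1 p.2) : LipOnBounded f := by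
  intro R
  obtain ⟨K, hK⟩ := (hf.locallyLipschitzOn (s := Metric.closedBall 0 R)
    ).exists_lipschitzOnWith_of_compact (isCompact_closedBall _ _)
  refine ⟨K, K.2, fun x x' u u' D hx hx' hu hu' hxx huu => ?_⟩
  have h := hK.dist_le_mul (x, u) (by simp [Prod.norm_def, hx, hu]) (x', u')
    (by simp [Prod.norm_def, hx', hu'])
  rw [dist_eq_norm, dist_eq_norm] at h
  refine h.trans (mul_le_mul_of_nonneg_left ?_ K.2)
  simp [Prod.norm_def, hxx, huu]

/-- In the control variable `f` is only locally Lipschitz, so the constant depends on the radius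
`R`. The growth bound keeps all iterates in a ball of radius proportional to `R`, on which `f` has a
single Lipschitz constant. -/
theorem exists_lip_picardIter (hfc : Continuous fun p : _ × _ => f p.1 p.2) (hfl : LipOnBounded f)
    {L : ℝ} (hL : 0 ≤ L) (hgrowth : ∀ x u, ‖f x u‖ ≤ L * ‖x‖ + L * ‖u‖) {T : ℝ} (hT : 0 ≤ T)
    (l : ℕ) (R : ℝ) : ∃ K, 0 ≤ K ∧ ∀ (x x' : EuclideanSpace ℝ (Fin n))
      (u u' : ℝ → EuclideanSpace ℝ (Fin m)) (D : ℝ), Continuous u → Continuous u' →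
      ‖x‖ ≤ R → ‖x'‖ ≤ R → (∀ s ∈ Icc 0 T, ‖u s‖ ≤ R) → (∀ s ∈ Icc 0 T, ‖u' s‖ ≤ R) →
      ‖x - x'‖ ≤ D → (∀ s ∈ Icc 0 T, ‖u s - u' s‖ ≤ D) → ∀ t ∈ Icc 0 T,
      ‖((picardOp f u)^[l] fun _ => x) t - ((picardOp f u')^[l] fun _ => x') t‖ ≤ K * D := by
  induction l with
  | zero => exact ⟨1, zero_le_one, fun x x' u u' D _ _ _ _ _ _ h _ t _ => by simpa using h⟩
  | succ l ih =>
    obtain ⟨K, hK, h⟩ := ih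
    obtain ⟨C, hC, hCl⟩ := exists_norm_picardIter_le hL hgrowth hT l
    obtain ⟨K', hK', hfK⟩ := hfl ((C + 1) * R)
    refine ⟨1 + K' * (K + 1) * T, by positivity, ?_⟩
    intro x x' u u' D hu hu' hx hx' hus hus' hD huD t ht
    have hR : 0 ≤ R := (norm_nonneg _).trans hx
    have hD0 : 0 ≤ D := (norm_nonneg _).trans hD
    have hCR : 0 ≤ C * R := mul_nonneg hC hR
    rw [picardIter_succ, picardIter_succ, add_sub_add_comm, ← intervalIntegral.integral_sub]
    · have := norm_integral_le_mul (C := K' * ((K + 1) * D))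
        (g := fun τ => f (((picardOp f u)^[l] fun _ => x) τ) (u τ) -
          f (((picardOp f u')^[l] fun _ => x') τ) (u' τ)) (fun s hs => ?_) ht
      · refine (norm_add_le _ _).trans ?_
        linarith
      · have hKD : 0 ≤ K * D := mul_nonneg hK hD0
        refine hfK _ _ _ _ _ ?_ ?_ ?_ ?_ ?_ ?_
        · linarith [hCl x u R hx hus s hs]
        · linarith [hCl x' u' R hx' hus' s hs]
        · linarith [hus s hs]
        · linarith [hus' s hs]
        · linarith [h x x' u u' D hu hu' hx hx' hus hus' hD huD s hs]
        · linarith [huD s hs]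
    · exact (hfc.comp ((continuous_picardIter hfc hu x l).prodMk hu)).intervalIntegrable _ _
    · exact (hfc.comp ((continuous_picardIter hfc hu' x' l).prodMk hu')).intervalIntegrable _ _

theorem mem_Icc_window {T : ℝ} (hT : 0 ≤ T) {i N : ℕ} (hi : i + 1 ≤ N) {s : ℝ}
    (hs : s ∈ Icc 0 T) : s + i * T ∈ Icc 0 (N * T) := by
  have h1 : ((i : ℝ) + 1) * T ≤ N * T :=
    mul_le_mul_of_nonneg_right (by exact_mod_cast hi) hT
  have h2 : 0 ≤ (i : ℝ) * T := by positivity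
  exact ⟨by linarith [hs.1], by linarith [hs.2]⟩

theorem exists_norm_picardSteps_le {L : ℝ} (hL : 0 ≤ L)
    (hgrowth : ∀ x u, ‖f x u‖ ≤ L * ‖x‖ + L * ‖u‖) {T : ℝ} (hT : 0 ≤ T) (l N i : ℕ)
    (hi : i ≤ N) :
    ∃ C, 0 ≤ C ∧ ∀ (x : EuclideanSpace ℝ (Fin n)) (u : ℝ → EuclideanSpace ℝ (Fin m)) (S : ℝ),
      ‖x‖ ≤ S → (∀ s ∈ Icc 0 (N * T), ‖u s‖ ≤ S) → ‖picardSteps f l T u x i‖ ≤ C * S := by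
  induction i with
  | zero => exact ⟨1, zero_le_one, fun x u S hx _ => by simpa [picardSteps] using hx⟩
  | succ i ih =>
    obtain ⟨C, hC, h⟩ := ih (by omega)
    obtain ⟨C', hC', h'⟩ := exists_norm_picardIter_le hL hgrowth hT l
    refine ⟨C' * (C + 1), by positivity, fun x u S hx hu => ?_⟩
    have hS : 0 ≤ S := (norm_nonneg _).trans hx
    have hCS : 0 ≤ C * S := mul_nonneg hC hS
    have := h' (picardSteps f l T u x i) (fun s => u (s + i * T)) ((C + 1) * S)
      (by linarith [h x u S hx hu])
      (fun s hs => by linarith [hu _ (mem_Icc_window hT hi hs)]) T ⟨hT, le_rfl⟩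
    rw [mul_assoc]
    exact this

theorem exists_lip_picardSteps (hfc : Continuous fun p : _ × _ => f p.1 p.2) (hfl : LipOnBounded f)
    {L : ℝ} (hL : 0 ≤ L) (hgrowth : ∀ x u, ‖f x u‖ ≤ L * ‖x‖ + L * ‖u‖) {T : ℝ} (hT : 0 ≤ T)
    (l N i : ℕ) (hi : i ≤ N) (R : ℝ) : ∃ K, 0 ≤ K ∧ ∀ (x x' : EuclideanSpace ℝ (Fin n))
      (u u' : ℝ → EuclideanSpace ℝ (Fin m)) (D : ℝ), Continuous u → Continuous u' →
      ‖x‖ ≤ R → ‖x'‖ ≤ R → (∀ s ∈ Icc 0 (N * T), ‖u s‖ ≤ R) →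
      (∀ s ∈ Icc 0 (N * T), ‖u' s‖ ≤ R) →
      ‖x - x'‖ ≤ D → (∀ s ∈ Icc 0 (N * T), ‖u s - u' s‖ ≤ D) →
      ‖picardSteps f l T u x i - picardSteps f l T u' x' i‖ ≤ K * D := by
  induction i with
  | zero => exact ⟨1, zero_le_one, fun x x' u u' D _ _ _ _ _ _ h _ => by
      simpa [picardSteps] using h⟩
  | succ i ih =>
    obtain ⟨K, hK, h⟩ := ih (by omega)
    obtain ⟨C, hC, hCl⟩ := exists_norm_picardSteps_le hL hgrowth hT l N i (by omega)
    obtain ⟨K', hK', h'⟩ := exists_lip_picardIter hfc hfl hL hgrowth hT l ((C + 1) * R)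
    refine ⟨K' * (K + 1), by positivity, ?_⟩
    intro x x' u u' D hu hu' hx hx' hus hus' hD huD
    have hR : 0 ≤ R := (norm_nonneg _).trans hx
    have hD0 : 0 ≤ D := (norm_nonneg _).trans hD
    have hCR : 0 ≤ C * R := mul_nonneg hC hR
    have hKD : 0 ≤ K * D := mul_nonneg hK hD0
    have := h' (picardSteps f l T u x i) (picardSteps f l T u' x' i) (fun s => u (s + i * T))
      (fun s => u' (s + i * T)) ((K + 1) * D) (by fun_prop) (by fun_prop)
      (by linarith [hCl x u R hx hus]) (by linarith [hCl x' u' R hx' hus'])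
      (fun s hs => by linarith [hus _ (mem_Icc_window hT hi hs)])
      (fun s hs => by linarith [hus' _ (mem_Icc_window hT hi hs)])
      (by linarith [h x x' u u' D hu hu' hx hx' hus hus' hD huD])
      (fun s hs => by linarith [huD _ (mem_Icc_window hT hi hs)]) T ⟨hT, le_rfl⟩
    rw [mul_assoc]
    exact this

theorem mem_Icc_shift {r : ℝ} {q : ℕ} (hq : 0 < q) {s : ℝ}
    (hs : s ∈ Icc 0 (q * (r / q))) : s - r ∈ Icc (-r) 0 := by
  rw [mul_div_cancel₀ _ (by positivity)] at hs
  exact ⟨by linarith [hs.1], by linarith [hs.2]⟩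

theorem exists_norm_predictor_le {L : ℝ} (hL : 0 ≤ L)
    (hgrowth : ∀ x u, ‖f x u‖ ≤ L * ‖x‖ + L * ‖u‖) {r : ℝ} (hr : 0 ≤ r) {q : ℕ} (hq : 0 < q)
    (l : ℕ) :
    ∃ C, 0 ≤ C ∧ ∀ (x : EuclideanSpace ℝ (Fin n)) (u : ℝ → EuclideanSpace ℝ (Fin m)) (S : ℝ),
      ‖x‖ ≤ S → (∀ θ ∈ Icc (-r) 0, ‖u θ‖ ≤ S) → ‖predictor f r l q x u‖ ≤ C * S := by
  obtain ⟨C, hC, h⟩ := exists_norm_picardSteps_le (T := r / q) hL hgrowth (by positivity) l q q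
    le_rfl
  exact ⟨C, hC, fun x u S hx hu => h x _ S hx fun s hs => hu _ (mem_Icc_shift hq hs)⟩

theorem exists_lip_predictor (hfc : Continuous fun p : _ × _ => f p.1 p.2) (hfl : LipOnBounded f)
    {L : ℝ} (hL : 0 ≤ L) (hgrowth : ∀ x u, ‖f x u‖ ≤ L * ‖x‖ + L * ‖u‖) {r : ℝ} (hr : 0 ≤ r)
    {q : ℕ} (hq : 0 < q) (l : ℕ) (R : ℝ) : ∃ K, 0 ≤ K ∧ ∀ (x x' : EuclideanSpace ℝ (Fin n))
      (u u' : ℝ → EuclideanSpace ℝ (Fin m)) (D : ℝ), Continuous u → Continuous u' →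
      ‖x‖ ≤ R → ‖x'‖ ≤ R → (∀ θ ∈ Icc (-r) 0, ‖u θ‖ ≤ R) → (∀ θ ∈ Icc (-r) 0, ‖u' θ‖ ≤ R) →
      ‖x - x'‖ ≤ D → (∀ θ ∈ Icc (-r) 0, ‖u θ - u' θ‖ ≤ D) →
      ‖predictor f r l q x u - predictor f r l q x' u'‖ ≤ K * D := by
  obtain ⟨K, hK, h⟩ := exists_lip_picardSteps (T := r / q) hfc hfl hL hgrowth (by positivity) l q q
    le_rfl R
  exact ⟨K, hK, fun x x' u u' D hu hu' hx hx' hus hus' hD huD => h x x' _ _ D (by fun_prop)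
    (by fun_prop) hx hx' (fun s hs => hus _ (mem_Icc_shift hq hs))
    (fun s hs => hus' _ (mem_Icc_shift hq hs)) hD (fun s hs => huD _ (mem_Icc_shift hq hs))⟩

/-- The trajectory `y` is a fixed point of the same Picard operator up to the mismatch `x - y 0` of
initial values. An iteration contracts the distance by `LT` and adds this mismatch again: the first
summand is the resulting geometric series, the second is the contracted initial distance. -/
theorem norm_picardIter_sub_le (hfc : Continuous fun p : _ × _ => f p.1 p.2) {L : ℝ} (hL : 0 ≤ L)
    (hLip : ∀ x y u, ‖f x u - f y u‖ ≤ L * ‖x - y‖) {T : ℝ} (hLT : L * T < 1)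
    {u : ℝ → EuclideanSpace ℝ (Fin m)} (hu : Continuous u) {y : ℝ → EuclideanSpace ℝ (Fin n)}
    (hy : Continuous y) (hyf : ∀ t ∈ Icc 0 T, y t = y 0 + ∫ s in (0 : ℝ)..t, f (y s) (u s))
    {S : ℝ} (hS : ∀ t ∈ Icc 0 T, ‖y t‖ ≤ S) (x : EuclideanSpace ℝ (Fin n)) (l : ℕ) :
    ∀ t ∈ Icc 0 T, ‖((picardOp f u)^[l] fun _ => x) t - y t‖ ≤
      ‖x - y 0‖ / (1 - L * T) + (L * T) ^ l * (‖x - y 0‖ + 2 * S) := by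
  have hρ : 0 < 1 - L * T := by linarith
  induction l with
  | zero =>
    intro t ht
    have h0 : (0 : ℝ) ∈ Icc 0 T := ⟨le_rfl, ht.1.trans ht.2⟩
    have h1 : x - y t = (x - y 0) + (y 0 - y t) := by abel
    have h2 : 0 ≤ ‖x - y 0‖ / (1 - L * T) := by positivity
    have h3 : ‖y 0 - y t‖ ≤ 2 * S := by
      linarith [norm_sub_le (y 0) (y t), hS 0 h0, hS t ht]
    have h4 := norm_add_le (x - y 0) (y 0 - y t)
    simp only [Function.iterate_zero, id, pow_zero, one_mul, h1]
    rw [← h1] at h4 ⊢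
    linarith
  | succ l ih =>
    intro t ht
    rw [picardIter_succ, hyf t ht, add_sub_add_comm, ← intervalIntegral.integral_sub]
    · have := norm_integral_le_mul (C := L * (‖x - y 0‖ / (1 - L * T) +
          (L * T) ^ l * (‖x - y 0‖ + 2 * S)))
        (g := fun τ => f (((picardOp f u)^[l] fun _ => x) τ) (u τ) - f (y τ) (u τ))
        (fun s hs => (hLip _ _ _).trans (mul_le_mul_of_nonneg_left (ih s hs) hL)) ht
      refine (norm_add_le _ _).trans ?_
      -- The first summand is the fixed point of `a ↦ ‖x - y 0‖ + LT·a`, hence reproduces itself.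
      have h3 : ‖x - y 0‖ + L * T * (‖x - y 0‖ / (1 - L * T)) = ‖x - y 0‖ / (1 - L * T) := by
        field_simp
        ring
      rw [pow_succ]
      linarith
    · exact (hfc.comp ((continuous_picardIter hfc hu x l).prodMk hu)).intervalIntegrable _ _
    · exact (hfc.comp (hy.prodMk hu)).intervalIntegrable _ _

/-- The error inherited from earlier windows enters the next one as a mismatch of initial values. It
is amplified by a factor independent of `l`, so after finitely many windows the factor `(LT)^l`
survives. The quantifier order, `c` before `l`, is the point. -/
theorem exists_norm_picardSteps_sub_le (hfc : Continuous fun p : _ × _ => f p.1 p.2) {L : ℝ}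
    (hL : 0 ≤ L) (hLip : ∀ x y u, ‖f x u - f y u‖ ≤ L * ‖x - y‖) {T : ℝ} (hT : 0 ≤ T)
    (hLT : L * T < 1) (N i : ℕ) (hi : i ≤ N) :
    ∃ c, 0 ≤ c ∧ ∀ (l : ℕ) (u : ℝ → EuclideanSpace ℝ (Fin m)) (y : ℝ → EuclideanSpace ℝ (Fin n))
      (S : ℝ), Continuous u → Continuous y →
      (∀ t ∈ Icc 0 (N * T), y t = y 0 + ∫ s in (0 : ℝ)..t, f (y s) (u s)) →
      (∀ t ∈ Icc 0 (N * T), ‖y t‖ ≤ S) →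
      ‖picardSteps f l T u (y 0) i - y (i * T)‖ ≤ c * (L * T) ^ l * S := by
  induction i with
  | zero => exact ⟨0, le_rfl, fun l u y S _ _ _ _ => by simp [picardSteps]⟩
  | succ i ih =>
    obtain ⟨c, hc, h⟩ := ih (by omega)
    have hρ : 0 < 1 - L * T := by linarith
    have hρ0 : 0 ≤ L * T := by positivity
    -- The inherited error contributes `c/(1 - LT)` through the geometric series and `c` through the
    -- contracted initial distance (using `(LT)^l ≤ 1`); the oscillation of `y` over the window
    -- contributes `2`.
    refine ⟨c / (1 - L * T) + c + 2, by positivity, fun l u y S hu hy hyf hS => ?_⟩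
    have hS0 : 0 ≤ S := (norm_nonneg _).trans (hS 0 ⟨le_rfl, by positivity⟩)
    have hci : ∀ a b : ℝ, IntervalIntegrable (fun s => f (y s) (u s)) volume a b := fun a b =>
      (hfc.comp (hy.prodMk hu)).intervalIntegrable a b
    have hz := norm_picardIter_sub_le hfc hL hLip hLT (u := fun s => u (s + i * T))
      (y := fun s => y (s + i * T)) (by fun_prop) (by fun_prop) (S := S) (fun t ht => ?_)
      (fun t ht => hS _ (mem_Icc_window hT hi ht)) (picardSteps f l T u (y 0) i) l T ⟨hT, le_rfl⟩
    · have hpl : (L * T) ^ l ≤ 1 := pow_le_one₀ hρ0 hLT.le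
      have hpl0 : 0 ≤ (L * T) ^ l := pow_nonneg hρ0 l
      have hd := h l u y S hu hy hyf hS
      have e1 : T + i * T = ((i + 1 : ℕ) : ℝ) * T := by push_cast; ring
      simp only [e1, zero_add] at hz
      simp only [picardSteps, picardEnd]
      refine hz.trans ?_
      have h1 := div_le_div_of_nonneg_right hd hρ.le
      have h2 := mul_le_mul hpl hd (norm_nonneg _) zero_le_one
      have h3 : c * (L * T) ^ l * S / (1 - L * T) = c / (1 - L * T) * (L * T) ^ l * S := by
        ring
      linarith
    · have h0 : (0 : ℝ) ∈ Icc 0 T := ⟨le_rfl, hT⟩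
      have h1 := hyf _ (mem_Icc_window hT hi ht)
      have h2 := hyf _ (mem_Icc_window hT hi h0)
      have h3 := intervalIntegral.integral_comp_add_right (fun s => f (y s) (u s)) (a := 0) (b := t)
        (i * T : ℝ)
      rw [h3, h1, h2, add_assoc, intervalIntegral.integral_add_adjacent_intervals (hci _ _)
        (hci _ _)]

/-- The error of the approximate predictor is geometrically small in the number of Picard
iterations, relatively to the exact trajectory. -/
theorem exists_norm_predictor_sub_le (hfc : Continuous fun p : _ × _ => f p.1 p.2) {L : ℝ}
    (hL : 0 ≤ L) (hLip : ∀ x y u, ‖f x u - f y u‖ ≤ L * ‖x - y‖) {r : ℝ} (hr : 0 ≤ r) {q : ℕ}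
    (hq : 0 < q) (hLr : L * r < q) :
    ∃ c, 0 ≤ c ∧ ∀ (l : ℕ) (u : ℝ → EuclideanSpace ℝ (Fin m)) (y : ℝ → EuclideanSpace ℝ (Fin n))
      (S : ℝ), Continuous u → Continuous y →
      (∀ t ∈ Icc 0 r, y t = y 0 + ∫ s in (0 : ℝ)..t, f (y s) (u (s - r))) →
      (∀ t ∈ Icc 0 r, ‖y t‖ ≤ S) →
      ‖predictor f r l q (y 0) u - y r‖ ≤ c * (L * (r / q)) ^ l * S := by
  have hq' : (0 : ℝ) < q := by positivity
  have e : (q : ℝ) * (r / q) = r := mul_div_cancel₀ _ hq'.ne'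
  obtain ⟨c, hc, h⟩ := exists_norm_picardSteps_sub_le hfc hL hLip (T := r / q) (by positivity)
    (by rw [← mul_div_assoc, div_lt_one hq']; exact hLr) q q le_rfl
  refine ⟨c, hc, fun l u y S hu hy hyf hS => ?_⟩
  have := h l (fun s => u (s - r)) y S (by fun_prop) hy (by rwa [e]) (by rwa [e])
  rwa [e] at this

end Picard

/-! ### Causal functional differential equations: existence and uniqueness on the half-line. -/

section FunctionalODE

variable {E : Type*} [NormedAddCommGroup E] [NormedSpace ℝ E]

/-- Integration gains a factor `1/lam` in a norm weighted by `exp(-lam t)`. With `lam = 2K + 1` an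
integral operator of constant `K` becomes a contraction with ratio at most `1/2` on an interval of
any length; since the weight is monotone, dependence on the past does no harm. -/
theorem norm_integral_le_exp [CompleteSpace E] {g : ℝ → E} (hg : Continuous g) {A lam t : ℝ} (hA : 0 ≤ A)
    (hlam : 0 < lam) (ht : 0 ≤ t) (h : ∀ s ∈ Icc 0 t, ‖g s‖ ≤ A * Real.exp (lam * s)) :
    ‖∫ s in (0 : ℝ)..t, g s‖ ≤ A / lam * Real.exp (lam * t) := by
  have h1 : ∀ s ∈ Ico 0 t, ‖g s‖ ≤ A / lam * (Real.exp (lam * s) * lam) := fun s hs => by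
    refine (h s ⟨hs.1, hs.2.le⟩).trans (le_of_eq ?_)
    field_simp
  have hd : ∀ s, HasDerivAt (fun t => ∫ s in (0 : ℝ)..t, g s) (g s) s := fun s =>
    hg.integral_hasStrictDerivAt 0 s |>.hasDerivAt
  refine image_norm_le_of_norm_deriv_right_le_deriv_boundary (a := 0) (b := t)
    (f := fun t => ∫ s in (0 : ℝ)..t, g s) (f' := g)
    (fun s _ => (hd s).continuousAt.continuousWithinAt)
    (fun s _ => (hd s).hasDerivWithinAt) (B := fun t => A / lam * Real.exp (lam * t))
    (B' := fun s => A / lam * (Real.exp (lam * s) * lam)) ?_ (fun s => ?_) h1 ⟨ht, le_rfl⟩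
  · simp only [intervalIntegral.integral_same, norm_zero]
    positivity
  · have := ((hasDerivAt_id s).const_mul lam).exp.const_mul (A / lam)
    simpa using this

/-- A causal functional of a path, of linear growth and Lipschitz on bounded sets: the right-hand
side of a functional differential equation on `[0,∞)`. -/
structure IsCausalField (G : (ℝ → E) → ℝ → E) : Prop where
  continuous : ∀ z, Continuous z → Continuous (G z)
  growth : ∃ K c : ℝ, 0 ≤ K ∧ 0 ≤ c ∧ ∀ z t S, 0 ≤ t → Continuous z →
    (∀ s ∈ Icc 0 t, ‖z s‖ ≤ S) → ‖G z t‖ ≤ K * (c + S)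
  lipschitz : ∀ R, ∃ K, 0 ≤ K ∧ ∀ z z' t D, 0 ≤ t → Continuous z → Continuous z' →
    (∀ s ∈ Icc 0 t, ‖z s‖ ≤ R) → (∀ s ∈ Icc 0 t, ‖z' s‖ ≤ R) →
    (∀ s ∈ Icc 0 t, ‖z s - z' s‖ ≤ D) → ‖G z t - G z' t‖ ≤ K * D

theorem le_mul_exp {A lam t : ℝ} (hA : 0 ≤ A) (hlam : 0 ≤ lam) (ht : 0 ≤ t) :
    A ≤ A * Real.exp (lam * t) :=
  le_mul_of_one_le_right hA (Real.one_le_exp (mul_nonneg hlam ht))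

theorem mul_exp_le {A lam s t : ℝ} (hA : 0 ≤ A) (hlam : 0 ≤ lam) (hst : s ≤ t) :
    A * Real.exp (lam * s) ≤ A * Real.exp (lam * t) :=
  mul_le_mul_of_nonneg_left (Real.exp_le_exp.2 (mul_le_mul_of_nonneg_left hst hlam)) hA

theorem div_two_mul_add_one_le {K : ℝ} (hK : 0 ≤ K) {A : ℝ} (hA : 0 ≤ A) :
    K * A / (2 * K + 1) ≤ A / 2 := by
  rw [div_le_div_iff₀ (by positivity) (by positivity)]
  nlinarith

theorem IsCausalField.eqOn_of_integral_eq [CompleteSpace E] {G : (ℝ → E) → ℝ → E} (hG : IsCausalField G) {z₀ : E}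
    {b : ℝ} {z z' : ℝ → E} (hz : Continuous z) (hz' : Continuous z')
    (h : ∀ t ∈ Icc 0 b, z t = z₀ + ∫ s in (0 : ℝ)..t, G z s)
    (h' : ∀ t ∈ Icc 0 b, z' t = z₀ + ∫ s in (0 : ℝ)..t, G z' s) : EqOn z z' (Icc 0 b) := by
  rcases lt_or_ge b 0 with hb | hb
  · simp [hb]
  obtain ⟨R₁, hR₁⟩ := isCompact_Icc.exists_bound_of_continuousOn (hz.continuousOn (s := Icc 0 b))
  obtain ⟨R₂, hR₂⟩ := isCompact_Icc.exists_bound_of_continuousOn (hz'.continuousOn (s := Icc 0 b))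
  obtain ⟨K, hK, hKl⟩ := hG.lipschitz (max R₁ R₂)
  set lam := 2 * K + 1 with hlam
  have hlam0 : 0 < lam := by positivity
  -- The weighted difference attains its maximum `S`; inserting the integral equations at the
  -- maximising time yields `S ≤ S/2`.
  obtain ⟨T, hT, hmax⟩ := isCompact_Icc.exists_isMaxOn (nonempty_Icc.2 hb)
    (f := fun t => ‖z t - z' t‖ * Real.exp (-(lam * t))) (by fun_prop)
  set S := ‖z T - z' T‖ * Real.exp (-(lam * T)) with hS
  have hS0 : 0 ≤ S := by positivity
  have hle : ∀ t ∈ Icc 0 b, ‖z t - z' t‖ ≤ S * Real.exp (lam * t) := fun t ht => by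
    have h1 : ‖z t - z' t‖ * Real.exp (-(lam * t)) ≤ S := hmax ht
    have h2 := mul_le_mul_of_nonneg_right h1 (Real.exp_pos (lam * t)).le
    rwa [mul_assoc, ← Real.exp_add, neg_add_cancel, Real.exp_zero, mul_one] at h2
  have hdiff : ‖z T - z' T‖ ≤ S / 2 * Real.exp (lam * T) := by
    rw [h T hT, h' T hT, add_sub_add_left_eq_sub, ← intervalIntegral.integral_sub
      ((hG.continuous z hz).intervalIntegrable _ _) ((hG.continuous z' hz').intervalIntegrable _ _)]
    refine (norm_integral_le_exp ((hG.continuous z hz).sub (hG.continuous z' hz')) (A := K * S)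
      (by positivity) hlam0 hT.1 fun s hs => ?_).trans ?_
    · rw [mul_assoc]
      have hsub : ∀ τ ∈ Icc 0 s, τ ∈ Icc 0 b := fun τ hτ =>
        ⟨hτ.1, hτ.2.trans (hs.2.trans hT.2)⟩
      exact hKl z z' s _ hs.1 hz hz' (fun τ hτ => (hR₁ τ (hsub τ hτ)).trans (le_max_left _ _))
        (fun τ hτ => (hR₂ τ (hsub τ hτ)).trans (le_max_right _ _))
        (fun τ hτ => (hle τ (hsub τ hτ)).trans (mul_exp_le hS0 hlam0.le hτ.2))
    · exact mul_le_mul_of_nonneg_right (div_two_mul_add_one_le hK hS0) (Real.exp_pos _).le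
  have hS1 : S ≤ S / 2 := by
    have h2 := mul_le_mul_of_nonneg_right hdiff (Real.exp_pos (-(lam * T))).le
    rwa [mul_assoc, ← Real.exp_add, add_neg_cancel, Real.exp_zero, mul_one] at h2
  have hS2 : S = 0 := by linarith
  intro t ht
  have := hle t ht
  rw [hS2, zero_mul] at this
  exact sub_eq_zero.1 (norm_le_zero_iff.1 this)

/-- Successive approximations for the functional equation `ż = G z`, `z(0) = z₀`. -/
noncomputable def approxPath (G : (ℝ → E) → ℝ → E) (z₀ : E) : ℕ → ℝ → E
  | 0 => fun _ => z₀
  | i + 1 => fun t => z₀ + ∫ s in (0 : ℝ)..t, G (approxPath G z₀ i) s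

theorem IsCausalField.continuous_approxPath {G : (ℝ → E) → ℝ → E} (hG : IsCausalField G) (z₀ : E)
    (i : ℕ) : Continuous (approxPath G z₀ i) := by
  induction i with
  | zero => exact continuous_const
  | succ i ih =>
    exact continuous_const.add (intervalIntegral.continuous_primitive
      (fun a b => (hG.continuous _ ih).intervalIntegrable a b) 0)

theorem IsCausalField.exists_norm_approxPath_le [CompleteSpace E] {G : (ℝ → E) → ℝ → E} (hG : IsCausalField G)
    (z₀ : E) : ∃ B lam : ℝ, 0 ≤ B ∧ 0 ≤ lam ∧ ∀ i t, 0 ≤ t →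
      ‖approxPath G z₀ i t‖ ≤ B * Real.exp (lam * t) := by
  obtain ⟨K, c, hK, hc, h⟩ := hG.growth
  -- Chosen so that `‖z₀‖ + (c + B)/2 = B`: the bound reproduces itself from one approximation to
  -- the next.
  set B := 2 * ‖z₀‖ + c with hBdef
  have hB : 0 ≤ B := by positivity
  have hlam : 0 < 2 * K + 1 := by positivity
  refine ⟨B, 2 * K + 1, hB, hlam.le, fun i => ?_⟩
  induction i with
  | zero =>
    intro t ht
    refine le_trans ?_ (le_mul_exp hB hlam.le ht)
    simp only [approxPath]
    linarith [norm_nonneg z₀]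
  | succ i ih =>
    intro t ht
    have h1 := norm_integral_le_exp (hG.continuous _ (hG.continuous_approxPath z₀ i))
      (A := K * (c + B)) (by positivity) hlam ht fun s hs => by
        refine (h _ s (B * Real.exp ((2 * K + 1) * s)) hs.1 (hG.continuous_approxPath z₀ i)
          fun τ hτ => (ih τ hτ.1).trans (mul_exp_le hB hlam.le hτ.2)).trans ?_
        rw [mul_assoc]
        refine mul_le_mul_of_nonneg_left ?_ hK
        linarith [le_mul_exp hc hlam.le hs.1]
    have h2 := mul_le_mul_of_nonneg_right (div_two_mul_add_one_le hK (add_nonneg hc hB))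
      (Real.exp_pos ((2 * K + 1) * t)).le
    have h3 := le_mul_exp (norm_nonneg z₀) hlam.le ht
    refine (norm_add_le _ _).trans ?_
    have h4 : B * Real.exp ((2 * K + 1) * t) = ‖z₀‖ * Real.exp ((2 * K + 1) * t) +
        (c + B) / 2 * Real.exp ((2 * K + 1) * t) := by rw [hBdef]; ring
    linarith

theorem IsCausalField.exists_dist_approxPath_le [CompleteSpace E] {G : (ℝ → E) → ℝ → E} (hG : IsCausalField G)
    (z₀ : E) (b : ℝ) : ∃ C : ℝ, ∀ i, ∀ t ∈ Icc 0 b,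
      dist (approxPath G z₀ i t) (approxPath G z₀ (i + 1) t) ≤ C / 2 / 2 ^ i := by
  obtain ⟨B, lam, hB, hlam, hbd⟩ := hG.exists_norm_approxPath_le z₀
  set R := B * Real.exp (lam * b) with hR
  have hR0 : 0 ≤ R := by positivity
  obtain ⟨K, hK, hKl⟩ := hG.lipschitz R
  have hbd' : ∀ i, ∀ t ∈ Icc 0 b, ‖approxPath G z₀ i t‖ ≤ R := fun i t ht =>
    (hbd i t ht.1).trans (mul_exp_le hB hlam ht.2)
  have hlam' : 0 < 2 * K + 1 := by positivity
  have key : ∀ i, ∀ t ∈ Icc 0 b, ‖approxPath G z₀ i t - approxPath G z₀ (i + 1) t‖ ≤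
      2 * R / 2 ^ i * Real.exp ((2 * K + 1) * t) := by
    intro i
    induction i with
    | zero =>
      intro t ht
      refine le_trans ?_ (le_mul_exp (by positivity) hlam'.le ht.1)
      rw [pow_zero, div_one]
      linarith [norm_sub_le (approxPath G z₀ 0 t) (approxPath G z₀ 1 t), hbd' 0 t ht, hbd' 1 t ht]
    | succ i ih =>
      intro t ht
      have hc1 := hG.continuous _ (hG.continuous_approxPath z₀ i)
      have hc2 := hG.continuous _ (hG.continuous_approxPath z₀ (i + 1))
      rw [approxPath, approxPath, add_sub_add_left_eq_sub, ← intervalIntegral.integral_sub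
        (hc1.intervalIntegrable _ _) (hc2.intervalIntegrable _ _)]
      refine (norm_integral_le_exp (hc1.sub hc2) (A := K * (2 * R / 2 ^ i)) (by positivity) hlam'
        ht.1 fun s hs => ?_).trans ?_
      · rw [mul_assoc]
        have hsub : ∀ τ ∈ Icc 0 s, τ ∈ Icc 0 b := fun τ hτ =>
          ⟨hτ.1, hτ.2.trans (hs.2.trans ht.2)⟩
        exact hKl _ _ s _ hs.1 (hG.continuous_approxPath z₀ i)
          (hG.continuous_approxPath z₀ (i + 1)) (fun τ hτ => hbd' _ τ (hsub τ hτ))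
          (fun τ hτ => hbd' _ τ (hsub τ hτ))
          (fun τ hτ => (ih τ (hsub τ hτ)).trans (mul_exp_le (by positivity) hlam'.le hτ.2))
      · refine mul_le_mul_of_nonneg_right ?_ (Real.exp_pos _).le
        refine (div_two_mul_add_one_le hK (by positivity)).trans (le_of_eq ?_)
        rw [pow_succ]
        field_simp
  refine ⟨2 * (2 * R * Real.exp ((2 * K + 1) * b)), fun i t ht => ?_⟩
  rw [dist_eq_norm]
  refine (key i t ht).trans ((mul_exp_le (by positivity) hlam'.le ht.2).trans (le_of_eq ?_))
  field_simp

theorem IsCausalField.exists_integral_eq [CompleteSpace E] {G : (ℝ → E) → ℝ → E}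
    (hG : IsCausalField G) (z₀ : E) :
    ∃ z : ℝ → E, Continuous z ∧ ∀ t, 0 ≤ t → z t = z₀ + ∫ s in (0 : ℝ)..t, G z s := by
  choose C hC using hG.exists_dist_approxPath_le z₀
  -- The approximations are controlled at nonnegative times only, so the limit path is taken at `max
  -- t 0`. This makes it constant for negative times and continuous on the whole line.
  have hmax : ∀ {t b : ℝ}, 0 ≤ b → t ≤ b → max t 0 ∈ Icc 0 b := fun hb htb =>
    ⟨le_max_right _ _, max_le htb hb⟩
  have hlim : ∀ t, ∃ y, Tendsto (fun i => approxPath G z₀ i (max t 0)) atTop (𝓝 y) := fun t =>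
    cauchySeq_tendsto_of_complete (cauchySeq_of_le_geometric_two (C := C (max t 0)) fun i =>
      hC _ i _ ⟨le_max_right _ _, le_rfl⟩)
  choose z hz using hlim
  have hdist : ∀ b, 0 ≤ b → ∀ i, ∀ t ≤ b,
      dist (approxPath G z₀ i (max t 0)) (z t) ≤ C b / 2 ^ i := fun b hb i t ht =>
    dist_le_of_le_geometric_two_of_tendsto (fun i => hC b i _ (hmax hb ht)) (hz t) i
  have hgeo : ∀ A : ℝ, Tendsto (fun i : ℕ => A / 2 ^ i) atTop (𝓝 0) := fun A => by
    have := (tendsto_pow_atTop_nhds_zero_of_lt_one (r := (1 / 2 : ℝ)) (by norm_num)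
      (by norm_num)).const_mul A
    simpa [div_eq_mul_inv] using this
  have hzc : Continuous z := by
    rw [continuous_iff_continuousAt]
    intro t
    have hb : 0 ≤ max t 0 + 1 := by positivity
    have hu : TendstoUniformlyOn (fun i t => approxPath G z₀ i (max t 0)) z atTop
        (Iic (max t 0 + 1)) := by
      rw [Metric.tendstoUniformlyOn_iff]
      intro ε hε
      filter_upwards [(hgeo (C (max t 0 + 1))).eventually_lt_const hε] with i hi s hs
      rw [dist_comm]
      exact (hdist _ hb i s hs).trans_lt hi
    refine (hu.continuousOn (Eventually.of_forall fun i => ?_).frequently).continuousAt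
      (Iic_mem_nhds (by linarith [le_max_left t 0]))
    exact ((hG.continuous_approxPath z₀ i).comp (continuous_id.max continuous_const)).continuousOn
  refine ⟨z, hzc, fun t ht => ?_⟩
  obtain ⟨B, lam, hB, hlam, hbd⟩ := hG.exists_norm_approxPath_le z₀
  have hbd' : ∀ i, ∀ s ∈ Icc 0 t, ‖approxPath G z₀ i s‖ ≤ B * Real.exp (lam * t) := fun i s hs =>
    (hbd i s hs.1).trans (mul_exp_le hB hlam hs.2)
  have hzlim : ∀ s, 0 ≤ s → Tendsto (fun i => approxPath G z₀ i s) atTop (𝓝 (z s)) := fun s hs => by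
    simpa [max_eq_left hs] using hz s
  have hzbd : ∀ s ∈ Icc 0 t, ‖z s‖ ≤ B * Real.exp (lam * t) := fun s hs =>
    le_of_tendsto (hzlim s hs.1).norm (Eventually.of_forall fun i => hbd' i s hs)
  obtain ⟨K, hK, hKl⟩ := hG.lipschitz (B * Real.exp (lam * t))
  have hcd : ∀ i, ∀ s ∈ Icc 0 t, ‖approxPath G z₀ i s - z s‖ ≤ C t / 2 ^ i := fun i s hs => by
    have := hdist t ht i s hs.2
    rwa [max_eq_left hs.1, dist_eq_norm] at this
  have h1 : Tendsto (fun i => ∫ s in (0 : ℝ)..t, G (approxPath G z₀ i) s) atTop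
      (𝓝 (∫ s in (0 : ℝ)..t, G z s)) := by
    rw [tendsto_iff_norm_sub_tendsto_zero]
    refine squeeze_zero (fun _ => norm_nonneg _) (fun i => ?_) (hgeo (K * C t * t))
    have hc1 := hG.continuous _ (hG.continuous_approxPath z₀ i)
    rw [← intervalIntegral.integral_sub (hc1.intervalIntegrable _ _)
      ((hG.continuous z hzc).intervalIntegrable _ _)]
    refine (norm_integral_le_mul (C := K * (C t / 2 ^ i)) (T := t) (fun s hs => ?_)
      ⟨ht, le_rfl⟩).trans (le_of_eq (by ring))
    have hsub : ∀ τ ∈ Icc 0 s, τ ∈ Icc 0 t := fun τ hτ => ⟨hτ.1, hτ.2.trans hs.2⟩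
    exact hKl _ _ s _ hs.1 (hG.continuous_approxPath z₀ i) hzc (fun τ hτ => hbd' i τ (hsub τ hτ))
      (fun τ hτ => hzbd τ (hsub τ hτ)) (fun τ hτ => hcd i τ (hsub τ hτ))
  exact tendsto_nhds_unique ((tendsto_add_atTop_iff_nat 1).2 (hzlim t ht))
    (tendsto_const_nhds.add h1)

end FunctionalODE

/-! ### The closed loop as a causal functional equation. -/

section ClosedLoop

variable {n m : ℕ}
  {f : EuclideanSpace ℝ (Fin n) → EuclideanSpace ℝ (Fin m) → EuclideanSpace ℝ (Fin n)}

/-- The linear feedback as a continuous linear map. -/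
noncomputable def feedbackCLM (k : Matrix (Fin n) (Fin m) ℝ) :
    EuclideanSpace ℝ (Fin n) →L[ℝ] EuclideanSpace ℝ (Fin m) :=
  LinearMap.toContinuousLinearMap
    { toFun := linFeedback k
      map_add' := fun x y => by simp [linFeedback, Matrix.mulVec_add]
      map_smul' := fun c x => by simp [linFeedback, Matrix.mulVec_smul] }

theorem linFeedback_eq (k : Matrix (Fin n) (Fin m) ℝ) (x : EuclideanSpace ℝ (Fin n)) :
    linFeedback k x = feedbackCLM k x := rfl

/-- The control `u₀` on `[-r, 0]`, prolonged by `v` on `[0, ∞)` in such a way that the result is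
continuous even where `v 0` differs from `u₀ 0`. -/
noncomputable def prolong {r : ℝ} (hr : 0 ≤ r) (u₀ : C(Icc (-r) 0, EuclideanSpace ℝ (Fin m)))
    (v : ℝ → EuclideanSpace ℝ (Fin m)) (s : ℝ) : EuclideanSpace ℝ (Fin m) :=
  u₀ (projIcc (-r) 0 (neg_nonpos.2 hr) s) - u₀ ⟨0, neg_nonpos.2 hr, le_rfl⟩ + v (max s 0)

variable {r : ℝ} (hr : 0 ≤ r) {u₀ : C(Icc (-r) 0, EuclideanSpace ℝ (Fin m))}
  {v v' : ℝ → EuclideanSpace ℝ (Fin m)}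

theorem continuous_prolong (hv : Continuous v) : Continuous (prolong hr u₀ v) :=
  ((u₀.continuous.comp continuous_projIcc).sub continuous_const).add
    (hv.comp (continuous_id.max continuous_const))

theorem prolong_of_nonneg {s : ℝ} (hs : 0 ≤ s) : prolong hr u₀ v s = v s := by
  simp [prolong, projIcc_of_right_le _ hs, max_eq_left hs]

theorem prolong_of_mem (hv : v 0 = u₀ ⟨0, neg_nonpos.2 hr, le_rfl⟩) (θ : Icc (-r) 0) :
    prolong hr u₀ v θ = u₀ θ := by
  simp [prolong, max_eq_right θ.2.2, hv]

theorem norm_prolong_le {t S : ℝ} (ht : 0 ≤ t) (h : ∀ s ∈ Icc 0 t, ‖v s‖ ≤ S) {s : ℝ}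
    (hs : s ≤ t) : ‖prolong hr u₀ v s‖ ≤ 2 * ‖u₀‖ + S := by
  have h1 := norm_add_le (u₀ (projIcc (-r) 0 (neg_nonpos.2 hr) s) -
    u₀ ⟨0, neg_nonpos.2 hr, le_rfl⟩) (v (max s 0))
  have h2 := norm_sub_le (u₀ (projIcc (-r) 0 (neg_nonpos.2 hr) s))
    (u₀ ⟨0, neg_nonpos.2 hr, le_rfl⟩)
  have h3 := u₀.norm_coe_le_norm (projIcc (-r) 0 (neg_nonpos.2 hr) s)
  have h4 := u₀.norm_coe_le_norm ⟨0, neg_nonpos.2 hr, le_rfl⟩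
  have h5 := h (max s 0) ⟨le_max_right _ _, max_le hs ht⟩
  rw [prolong]
  linarith

theorem norm_prolong_sub_le {t D : ℝ} (ht : 0 ≤ t) (h : ∀ s ∈ Icc 0 t, ‖v s - v' s‖ ≤ D) {s : ℝ}
    (hs : s ≤ t) : ‖prolong hr u₀ v s - prolong hr u₀ v' s‖ ≤ D := by
  rw [prolong, prolong, add_sub_add_left_eq_sub]
  exact h (max s 0) ⟨le_max_right _ _, max_le hs ht⟩

/-- The right-hand side of the closed loop along the paths `x`, `u`. -/
noncomputable def closedLoopField
    (f : EuclideanSpace ℝ (Fin n) → EuclideanSpace ℝ (Fin m) → EuclideanSpace ℝ (Fin n))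
    (k : Matrix (Fin n) (Fin m) ℝ) (r μ : ℝ) (l q : ℕ) (x : ℝ → EuclideanSpace ℝ (Fin n))
    (u : ℝ → EuclideanSpace ℝ (Fin m)) (t : ℝ) :
    EuclideanSpace ℝ (Fin n) × EuclideanSpace ℝ (Fin m) :=
  (f (x t) (u (t - r)),
    linFeedback k (f (predictor f r l q (x t) (history u t)) (u t))
      - μ • (u t - linFeedback k (predictor f r l q (x t) (history u t))))

theorem closedLoopField_congr {k : Matrix (Fin n) (Fin m) ℝ} {μ : ℝ} {l q : ℕ} (hq : 0 < q)
    {x x' : ℝ → EuclideanSpace ℝ (Fin n)} {u u' : ℝ → EuclideanSpace ℝ (Fin m)} {t : ℝ}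
    (hr : 0 ≤ r) (hx : x t = x' t) (hu : ∀ s ∈ Icc (t - r) t, u s = u' s) :
    closedLoopField f k r μ l q x u t = closedLoopField f k r μ l q x' u' t := by
  have h1 : predictor f r l q (x t) (history u t) = predictor f r l q (x' t) (history u' t) := by
    rw [hx]
    exact predictor_congr hr hq (fun θ hθ => hu _ ⟨by linarith [hθ.1], by linarith [hθ.2]⟩) _ _
  rw [closedLoopField, closedLoopField, h1, hx, hu t ⟨by linarith, le_rfl⟩,
    hu (t - r) ⟨le_rfl, by linarith⟩]

theorem continuous_closedLoopField (hfc : Continuous fun p : _ × _ => f p.1 p.2)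
    {k : Matrix (Fin n) (Fin m) ℝ} {μ : ℝ} {l q : ℕ}
    {x : ℝ → EuclideanSpace ℝ (Fin n)} {u : ℝ → EuclideanSpace ℝ (Fin m)} (hx : Continuous x)
    (hu : Continuous u) : Continuous (closedLoopField f k r μ l q x u) := by
  have hΦ := continuous_predictor_history hfc hx hu r l q
  have hF := (feedbackCLM k).continuous
  exact (hfc.comp (hx.prodMk (hu.comp (continuous_id.sub continuous_const)))).prodMk
    ((hF.comp (hfc.comp (hΦ.prodMk hu))).sub ((hu.sub (hF.comp hΦ)).const_smul μ))

/-- The initial history is built into the functional through `prolong`, so the unknown is a path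
starting at time zero with a prescribed value. The delayed and predicted terms look only at the past
of that path and at `u₀`, whence causality; the additive constant `2‖u₀‖` in the growth bound pays
for `u₀`. -/
theorem isCausalField_closedLoop (hfc : Continuous fun p : _ × _ => f p.1 p.2)
    (hfl : LipOnBounded f) {L : ℝ} (hL : 0 ≤ L) (hgrowth : ∀ x u, ‖f x u‖ ≤ L * ‖x‖ + L * ‖u‖)
    (k : Matrix (Fin n) (Fin m) ℝ) {μ : ℝ} (hμ : 0 ≤ μ) (l : ℕ) {q : ℕ} (hq : 0 < q)
    (u₀ : C(Icc (-r) 0, EuclideanSpace ℝ (Fin m))) :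
    IsCausalField fun z t => closedLoopField f k r μ l q (fun s => (z s).1)
      (prolong hr u₀ fun s => (z s).2) t where
  continuous z hz := continuous_closedLoopField hfc hz.fst (continuous_prolong hr hz.snd)
  growth := by
    obtain ⟨C, hC, hΦ⟩ := exists_norm_predictor_le hL hgrowth hr hq l
    set κ := ‖feedbackCLM k‖ with hκ
    have hκ0 : 0 ≤ κ := norm_nonneg _
    refine ⟨2 * L + κ * (L * C + L) + μ * (1 + κ * C), 2 * ‖u₀‖, by positivity, by positivity,
      fun z t S ht hz hS => ?_⟩
    have hx : ‖(z t).1‖ ≤ S := (norm_fst_le (z t)).trans (hS t ⟨ht, le_rfl⟩)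
    have hu : ∀ s ≤ t, ‖prolong hr u₀ (fun s => (z s).2) s‖ ≤ 2 * ‖u₀‖ + S := fun s hs =>
      norm_prolong_le hr ht (fun s hs => (norm_snd_le (z s)).trans (hS s hs)) hs
    have hx' : ‖(z t).1‖ ≤ 2 * ‖u₀‖ + S := by linarith [norm_nonneg u₀]
    set S' := 2 * ‖u₀‖ + S with hS'
    have hS0 : 0 ≤ S' := (norm_nonneg _).trans hx'
    have h1 := hΦ (z t).1 (history (prolong hr u₀ fun s => (z s).2) t) S' hx'
      fun θ hθ => hu _ (by linarith [hθ.2])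
    set p := predictor f r l q (z t).1 (history (prolong hr u₀ fun s => (z s).2) t)
    have g1 := hgrowth (z t).1 (prolong hr u₀ (fun s => (z s).2) (t - r))
    have g2 := hgrowth p (prolong hr u₀ (fun s => (z s).2) t)
    have a1 := mul_le_mul_of_nonneg_left hx' hL
    have a2 := mul_le_mul_of_nonneg_left (hu (t - r) (by linarith)) hL
    have a3 := mul_le_mul_of_nonneg_left (hu t le_rfl) hL
    have a4 := mul_le_mul_of_nonneg_left h1 hL
    have b1 : ‖feedbackCLM k (f p (prolong hr u₀ (fun s => (z s).2) t))‖ ≤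
        κ * ((L * C + L) * S') :=
      ((feedbackCLM k).le_opNorm _).trans (mul_le_mul_of_nonneg_left (by linarith) hκ0)
    have b2 : ‖feedbackCLM k p‖ ≤ κ * (C * S') :=
      ((feedbackCLM k).le_opNorm _).trans (mul_le_mul_of_nonneg_left h1 hκ0)
    have b3 := norm_sub_le (prolong hr u₀ (fun s => (z s).2) t) (feedbackCLM k p)
    have b4 : ‖μ • (prolong hr u₀ (fun s => (z s).2) t - feedbackCLM k p)‖ ≤
        μ * ((1 + κ * C) * S') := by
      rw [norm_smul, Real.norm_of_nonneg hμ]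
      exact mul_le_mul_of_nonneg_left (by linarith [hu t le_rfl]) hμ
    have c1 : 0 ≤ κ * ((L * C + L) * S') := by positivity
    have c2 : 0 ≤ μ * ((1 + κ * C) * S') := by positivity
    have c3 : 0 ≤ L * S' := by positivity
    refine max_le ?_ ((norm_sub_le _ _).trans ?_)
    · change ‖f (z t).1 (prolong hr u₀ (fun s => (z s).2) (t - r))‖ ≤ _
      linarith
    · change ‖feedbackCLM k (f p (prolong hr u₀ (fun s => (z s).2) t))‖ +
        ‖μ • (prolong hr u₀ (fun s => (z s).2) t - feedbackCLM k p)‖ ≤ _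
      linarith
  lipschitz R := by
    obtain ⟨C, hC, hΦ⟩ := exists_norm_predictor_le hL hgrowth hr hq l
    obtain ⟨K₁, hK₁, hΦl⟩ := exists_lip_predictor hfc hfl hL hgrowth hr hq l (2 * ‖u₀‖ + R)
    obtain ⟨K₂, hK₂, hfK⟩ := hfl ((C + 1) * (2 * ‖u₀‖ + R))
    set κ := ‖feedbackCLM k‖ with hκ
    have hκ0 : 0 ≤ κ := norm_nonneg _
    refine ⟨K₂ + κ * (K₂ * (K₁ + 1)) + μ * (1 + κ * K₁), by positivity,
      fun z z' t D ht hz hz' hzR hzR' hD => ?_⟩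
    have hx : ‖(z t).1‖ ≤ R := (norm_fst_le (z t)).trans (hzR t ⟨ht, le_rfl⟩)
    have hx' : ‖(z' t).1‖ ≤ R := (norm_fst_le (z' t)).trans (hzR' t ⟨ht, le_rfl⟩)
    have hxD : ‖(z t).1 - (z' t).1‖ ≤ D := (norm_fst_le (z t - z' t)).trans (hD t ⟨ht, le_rfl⟩)
    have hu : ∀ s ≤ t, ‖prolong hr u₀ (fun s => (z s).2) s‖ ≤ 2 * ‖u₀‖ + R := fun s hs =>
      norm_prolong_le hr ht (fun s hs => (norm_snd_le (z s)).trans (hzR s hs)) hs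
    have hu' : ∀ s ≤ t, ‖prolong hr u₀ (fun s => (z' s).2) s‖ ≤ 2 * ‖u₀‖ + R := fun s hs =>
      norm_prolong_le hr ht (fun s hs => (norm_snd_le (z' s)).trans (hzR' s hs)) hs
    have huD : ∀ s ≤ t, ‖prolong hr u₀ (fun s => (z s).2) s -
        prolong hr u₀ (fun s => (z' s).2) s‖ ≤ D := fun s hs =>
      norm_prolong_sub_le hr ht (fun s hs => (norm_snd_le (z s - z' s)).trans (hD s hs)) hs
    have hc := continuous_prolong hr (u₀ := u₀) hz.snd
    have hc' := continuous_prolong hr (u₀ := u₀) hz'.snd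
    have hD0 : 0 ≤ D := (norm_nonneg _).trans hxD
    have hu₀ := norm_nonneg u₀
    set w := prolong hr u₀ fun s => (z s).2
    set w' := prolong hr u₀ fun s => (z' s).2
    set R' := 2 * ‖u₀‖ + R with hR'
    have hRR : R ≤ R' := by linarith
    have hR0 : 0 ≤ R' := (norm_nonneg _).trans (hu t le_rfl)
    have hCR : 0 ≤ C * R' := by positivity
    have e1 := hΦ (z t).1 (history w t) R' (hx.trans hRR) fun θ hθ => hu _ (by linarith [hθ.2])
    have e2 := hΦ (z' t).1 (history w' t) R' (hx'.trans hRR)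
      fun θ hθ => hu' _ (by linarith [hθ.2])
    have e3 := hΦl (z t).1 (z' t).1 (history w t) (history w' t) D
      (hc.comp (continuous_const.add continuous_id)) (hc'.comp (continuous_const.add continuous_id))
      (hx.trans hRR) (hx'.trans hRR) (fun θ hθ => hu _ (by linarith [hθ.2]))
      (fun θ hθ => hu' _ (by linarith [hθ.2])) hxD (fun θ hθ => huD _ (by linarith [hθ.2]))
    set p := predictor f r l q (z t).1 (history w t)
    set p' := predictor f r l q (z' t).1 (history w' t)
    have hKD : 0 ≤ K₁ * D := by positivity
    have g1 : ‖f (z t).1 (w (t - r)) - f (z' t).1 (w' (t - r))‖ ≤ K₂ * D :=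
      hfK _ _ _ _ _ (by linarith) (by linarith) (by linarith [hu (t - r) (by linarith)])
        (by linarith [hu' (t - r) (by linarith)]) hxD (huD _ (by linarith))
    have g2 : ‖f p (w t) - f p' (w' t)‖ ≤ K₂ * ((K₁ + 1) * D) :=
      hfK _ _ _ _ _ (by linarith) (by linarith) (by linarith [hu t le_rfl])
        (by linarith [hu' t le_rfl]) (by linarith) (by linarith [huD t le_rfl])
    have b1 : ‖feedbackCLM k (f p (w t) - f p' (w' t))‖ ≤ κ * (K₂ * ((K₁ + 1) * D)) :=
      ((feedbackCLM k).le_opNorm _).trans (mul_le_mul_of_nonneg_left g2 hκ0)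
    have b2 : ‖feedbackCLM k (p - p')‖ ≤ κ * (K₁ * D) :=
      ((feedbackCLM k).le_opNorm _).trans (mul_le_mul_of_nonneg_left e3 hκ0)
    have b3 : ‖μ • ((w t - w' t) - feedbackCLM k (p - p'))‖ ≤ μ * ((1 + κ * K₁) * D) := by
      rw [norm_smul, Real.norm_of_nonneg hμ]
      refine mul_le_mul_of_nonneg_left ((norm_sub_le _ _).trans ?_) hμ
      linarith [huD t le_rfl]
    have c1 : 0 ≤ κ * (K₂ * ((K₁ + 1) * D)) := by positivity
    have c2 : 0 ≤ μ * ((1 + κ * K₁) * D) := by positivity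
    have c3 : 0 ≤ K₂ * D := by positivity
    refine max_le ?_ ?_
    · change ‖f (z t).1 (w (t - r)) - f (z' t).1 (w' (t - r))‖ ≤ _
      linarith
    · change ‖(feedbackCLM k (f p (w t)) - μ • (w t - feedbackCLM k p)) -
        (feedbackCLM k (f p' (w' t)) - μ • (w' t - feedbackCLM k p'))‖ ≤ _
      have : (feedbackCLM k (f p (w t)) - μ • (w t - feedbackCLM k p)) -
          (feedbackCLM k (f p' (w' t)) - μ • (w' t - feedbackCLM k p')) =
          feedbackCLM k (f p (w t) - f p' (w' t)) -
            μ • ((w t - w' t) - feedbackCLM k (p - p')) := by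
        rw [map_sub, map_sub]
        module
      rw [this]
      refine (norm_sub_le _ _).trans ?_
      linarith

theorem exists_isClosedLoopSolution (hr : 0 ≤ r) (hfc : Continuous fun p : _ × _ => f p.1 p.2)
    (hfl : LipOnBounded f) {L : ℝ} (hL : 0 ≤ L) (hgrowth : ∀ x u, ‖f x u‖ ≤ L * ‖x‖ + L * ‖u‖)
    (k : Matrix (Fin n) (Fin m) ℝ) {μ : ℝ} (hμ : 0 ≤ μ) (l : ℕ) {q : ℕ} (hq : 0 < q)
    (x₀ : EuclideanSpace ℝ (Fin n)) (u₀ : C(Icc (-r) 0, EuclideanSpace ℝ (Fin m))) :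
    ∃ x u, IsClosedLoopSolution f k r μ l q (Ici 0) x₀ u₀ x u := by
  have hG := isCausalField_closedLoop hr hfc hfl hL hgrowth k hμ l hq u₀
  obtain ⟨z, hz, hzi⟩ := hG.exists_integral_eq (x₀, u₀ ⟨0, neg_nonpos.2 hr, le_rfl⟩)
  have hz0 : z 0 = (x₀, u₀ ⟨0, neg_nonpos.2 hr, le_rfl⟩) := by simpa using hzi 0 le_rfl
  have hd : ∀ t ∈ Ici (0 : ℝ), HasDerivWithinAt z (closedLoopField f k r μ l q (fun s => (z s).1)
      (prolong hr u₀ fun s => (z s).2) t) (Ici 0) t := fun t ht => by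
    have h1 := ((hG.continuous z hz).integral_hasStrictDerivAt 0 t).hasDerivAt.const_add
      ((x₀, u₀ ⟨0, neg_nonpos.2 hr, le_rfl⟩) : EuclideanSpace ℝ (Fin n) × EuclideanSpace ℝ (Fin m))
    exact h1.hasDerivWithinAt.congr (fun s hs => hzi s hs) (hzi t ht)
  refine ⟨fun s => (z s).1, prolong hr u₀ fun s => (z s).2, by simp [hz0], fun θ => ?_,
    fun t ht => ?_, fun t ht => ?_⟩
  · exact prolong_of_mem hr (by simp [hz0]) θ
  · exact (hasFDerivAt_fst (𝕜 := ℝ)).comp_hasDerivWithinAt t (hd t ht)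
  · have := (hasFDerivAt_snd (𝕜 := ℝ)).comp_hasDerivWithinAt t (hd t ht)
    exact this.congr (fun s hs => prolong_of_nonneg hr hs) (prolong_of_nonneg hr ht)

variable {k : Matrix (Fin n) (Fin m) ℝ} {μ : ℝ} {l q : ℕ} {x₀ : EuclideanSpace ℝ (Fin n)}
  {x y : ℝ → EuclideanSpace ℝ (Fin n)} {u w : ℝ → EuclideanSpace ℝ (Fin m)}

theorem IsClosedLoopSolution.mono {I J : Set ℝ}
    (h : IsClosedLoopSolution f k r μ l q I x₀ u₀ x u) (hJ : J ⊆ I) :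
    IsClosedLoopSolution f k r μ l q J x₀ u₀ x u :=
  ⟨h.x_init, h.u_init, fun t ht => (h.x_deriv t (hJ ht)).mono hJ,
    fun t ht => (h.u_deriv t (hJ ht)).mono hJ⟩

/-- A solution on `[0, c)` may be arbitrary outside its domain, so it is frozen outside `[0, b]` to
obtain a globally continuous path. By causality the right-hand side on `[0, b]` does not notice the
change. Uniqueness for causal fields then applies on every such interval. -/
theorem IsClosedLoopSolution.integral_eq (hfc : Continuous fun p : _ × _ => f p.1 p.2)
    (hq : 0 < q) {b c : ℝ} (hb : 0 ≤ b) (hbc : b < c)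
    (h : IsClosedLoopSolution f k r μ l q (Ico 0 c) x₀ u₀ x u) :
    ∃ z : ℝ → EuclideanSpace ℝ (Fin n) × EuclideanSpace ℝ (Fin m), Continuous z ∧
      (∀ t ∈ Icc 0 b, z t = (x t, u t)) ∧
      ∀ t ∈ Icc 0 b, z t = (x₀, u₀ ⟨0, neg_nonpos.2 hr, le_rfl⟩) + ∫ s in (0 : ℝ)..t,
        closedLoopField f k r μ l q (fun s => (z s).1) (prolong hr u₀ fun s => (z s).2) s := by
  have hsub : Icc 0 b ⊆ Ico 0 c := fun t ht => ⟨ht.1, ht.2.trans_lt hbc⟩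
  have hd : ∀ t ∈ Icc 0 b, HasDerivWithinAt (fun t => (x t, u t))
      (closedLoopField f k r μ l q x u t) (Ico 0 c) t := fun t ht =>
    (h.x_deriv t (hsub ht)).prodMk (h.u_deriv t (hsub ht))
  have hcont : ContinuousOn (fun t => (x t, u t)) (Icc 0 b) := fun t ht =>
    (hd t ht).continuousWithinAt.mono hsub
  set z := IccExtend hb (domRestrict (Icc 0 b) fun t => (x t, u t)) with hz
  have hzc : Continuous z := (continuousOn_iff_continuous_domRestrict.1 hcont).Icc_extend'
  have hzb : ∀ t ∈ Icc 0 b, z t = (x t, u t) := fun t ht => IccExtend_of_mem hb _ ht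
  have hz0 : z 0 = (x₀, u₀ ⟨0, neg_nonpos.2 hr, le_rfl⟩) := by
    rw [hzb 0 ⟨le_rfl, hb⟩, h.x_init, ← h.u_init]
  have hfield : ∀ t ∈ Icc 0 b, closedLoopField f k r μ l q x u t =
      closedLoopField f k r μ l q (fun s => (z s).1) (prolong hr u₀ fun s => (z s).2) t := by
    intro t ht
    refine closedLoopField_congr hq hr (by rw [hzb t ht]) fun s hs => ?_
    rcases le_total 0 s with h0 | h0
    · rw [prolong_of_nonneg hr h0, hzb s ⟨h0, hs.2.trans ht.2⟩]
    · have hs' : s ∈ Icc (-r) 0 := ⟨by linarith [hs.1, ht.1], h0⟩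
      have h1 := h.u_init ⟨s, hs'⟩
      have h2 := prolong_of_mem hr (u₀ := u₀) (v := fun s => (z s).2) (by simp [hz0]) ⟨s, hs'⟩
      exact h1.trans h2.symm
  refine ⟨z, hzc, hzb, fun t ht => ?_⟩
  have hGc : Continuous (closedLoopField f k r μ l q (fun s => (z s).1)
      (prolong hr u₀ fun s => (z s).2)) :=
    continuous_closedLoopField hfc hzc.fst (continuous_prolong hr hzc.snd)
  rw [intervalIntegral.integral_eq_sub_of_hasDeriv_right_of_le ht.1 hzc.continuousOn
    (fun s hs => ?_) (hGc.intervalIntegrable _ _), hz0]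
  · abel
  · have hs' : s ∈ Ioo 0 b := ⟨hs.1, hs.2.trans_le ht.2⟩
    rw [← hfield s (Ioo_subset_Icc_self hs')]
    have h1 := (hd s (Ioo_subset_Icc_self hs')).hasDerivAt
      (Ico_mem_nhds hs'.1 (hs'.2.trans hbc))
    refine (h1.congr_of_eventuallyEq ?_).hasDerivWithinAt
    filter_upwards [Ioo_mem_nhds hs'.1 hs'.2] with τ hτ
    exact hzb τ (Ioo_subset_Icc_self hτ)

theorem IsClosedLoopSolution.eqOn (hr : 0 ≤ r) (hfc : Continuous fun p : _ × _ => f p.1 p.2)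
    (hfl : LipOnBounded f) {L : ℝ} (hL : 0 ≤ L) (hgrowth : ∀ x u, ‖f x u‖ ≤ L * ‖x‖ + L * ‖u‖)
    (hμ : 0 ≤ μ) (hq : 0 < q) {c : ℝ}
    (h : IsClosedLoopSolution f k r μ l q (Ico 0 c) x₀ u₀ x u)
    (h' : IsClosedLoopSolution f k r μ l q (Ico 0 c) x₀ u₀ y w) :
    EqOn x y (Ico 0 c) ∧ EqOn u w (Ico 0 c) := by
  have hG := isCausalField_closedLoop hr hfc hfl hL hgrowth k hμ l hq u₀
  have key : ∀ t ∈ Ico 0 c, (x t, u t) = (y t, w t) := by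
    intro t ht
    obtain ⟨z, hz, hzb, hzi⟩ := h.integral_eq hr hfc hq ht.1 ht.2
    obtain ⟨z', hz', hzb', hzi'⟩ := h'.integral_eq hr hfc hq ht.1 ht.2
    have h0 : t ∈ Icc 0 t := ⟨ht.1, le_rfl⟩
    rw [← hzb t h0, ← hzb' t h0]
    exact hG.eqOn_of_integral_eq hz hz' hzi hzi' h0
  exact ⟨fun t ht => congrArg Prod.fst (key t ht), fun t ht => congrArg Prod.snd (key t ht)⟩

end ClosedLoop

/-! ### Estimates along a global closed-loop trajectory. -/

section Trajectory

variable {n m : ℕ}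
  {f : EuclideanSpace ℝ (Fin n) → EuclideanSpace ℝ (Fin m) → EuclideanSpace ℝ (Fin n)}
  {k : Matrix (Fin n) (Fin m) ℝ} {r μ : ℝ} {l q : ℕ} {x₀ : EuclideanSpace ℝ (Fin n)}
  {u₀ : C(Icc (-r) 0, EuclideanSpace ℝ (Fin m))}
  {x : ℝ → EuclideanSpace ℝ (Fin n)} {u : ℝ → EuclideanSpace ℝ (Fin m)}

theorem IsClosedLoopSolution.continuousOn_fst
    (h : IsClosedLoopSolution f k r μ l q (Ici 0) x₀ u₀ x u) : ContinuousOn x (Ici 0) :=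
  fun t ht => (h.x_deriv t ht).continuousWithinAt

theorem IsClosedLoopSolution.continuousOn_snd
    (h : IsClosedLoopSolution f k r μ l q (Ici 0) x₀ u₀ x u) : ContinuousOn u (Ici 0) :=
  fun t ht => (h.u_deriv t ht).continuousWithinAt

theorem _root_.ContinuousOn.comp_max_zero {E : Type*} [TopologicalSpace E] {g : ℝ → E}
    (hg : ContinuousOn g (Ici 0)) : Continuous fun t => g (max t 0) :=
  hg.comp_continuous (continuous_id.max continuous_const) fun t => le_max_right t 0

theorem IsClosedLoopSolution.exists_continuous_extension (hr : 0 ≤ r)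
    (h : IsClosedLoopSolution f k r μ l q (Ici 0) x₀ u₀ x u) :
    ∃ x' u', Continuous x' ∧ Continuous u' ∧ (∀ t, 0 ≤ t → x' t = x t) ∧
      ∀ t, -r ≤ t → u' t = u t := by
  refine ⟨fun t => x (max t 0), prolong hr u₀ fun t => u (max t 0),
    h.continuousOn_fst.comp_max_zero, continuous_prolong hr h.continuousOn_snd.comp_max_zero,
    fun t ht => congrArg x (max_eq_left ht), fun t ht => ?_⟩
  rcases le_total 0 t with h0 | h0
  · rw [prolong_of_nonneg hr h0, max_eq_left h0]
  · rw [prolong_of_mem hr (v := fun t => u (max t 0)) ?_ ⟨t, ht, h0⟩]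
    · exact (h.u_init ⟨t, ht, h0⟩).symm
    · rw [max_self]
      exact h.u_init ⟨0, neg_nonpos.2 hr, le_rfl⟩

theorem IsClosedLoopSolution.x_eq_integral (hfc : Continuous fun p : _ × _ => f p.1 p.2)
    (hr : 0 ≤ r) (h : IsClosedLoopSolution f k r μ l q (Ici 0) x₀ u₀ x u) {a t : ℝ} (ha : 0 ≤ a)
    (ht : 0 ≤ t) :
    x (a + t) = x a + ∫ s in (0 : ℝ)..t, f (x (a + s)) (u (a + s - r)) := by
  obtain ⟨x', u', hx', hu', hx, hu⟩ := h.exists_continuous_extension hr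
  have hc : Continuous fun s => f (x' s) (u' (s - r)) :=
    hfc.comp (hx'.prodMk (hu'.comp (continuous_id.sub continuous_const)))
  have h1 : ∫ s in (0 : ℝ)..t, f (x (a + s)) (u (a + s - r)) =
      ∫ s in (0 : ℝ)..t, f (x' (a + s)) (u' (a + s - r)) := by
    refine intervalIntegral.integral_congr fun s hs => ?_
    rw [uIcc_of_le ht] at hs
    rw [hx (a + s) (by linarith [hs.1]), hu (a + s - r) (by linarith [hs.1])]
  rw [h1, intervalIntegral.integral_comp_add_left (fun s => f (x' s) (u' (s - r))),
    intervalIntegral.integral_eq_sub_of_hasDeriv_right_of_le (f := x) (by linarith)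
      (h.continuousOn_fst.mono fun s hs => ?_) (fun s hs => ?_) (hc.intervalIntegrable _ _),
    add_zero]
  · abel
  · rw [mem_Icc, add_zero] at hs
    exact ha.trans hs.1
  · rw [mem_Ioo, add_zero] at hs
    have h0 : 0 < s := ha.trans_lt hs.1
    rw [hx s h0.le, hu _ (by linarith)]
    exact ((h.x_deriv s h0.le).hasDerivAt (Ici_mem_nhds h0)).hasDerivWithinAt

/-- The stability hypothesis acts on the state only from time `r` on. Before that the state is
driven by the initial history alone, and Gronwall's inequality bounds it linearly in the data. -/
theorem exists_initial_bound {L : ℝ} (hL : 0 ≤ L)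
    (hgrowth : ∀ x u, ‖f x u‖ ≤ L * ‖x‖ + L * ‖u‖) (k : Matrix (Fin n) (Fin m) ℝ) (hr : 0 ≤ r) :
    ∃ c, 1 ≤ c ∧ ∀ {μ : ℝ} {l q : ℕ} {x₀ : EuclideanSpace ℝ (Fin n)}
      {u₀ : C(Icc (-r) 0, EuclideanSpace ℝ (Fin m))} {x : ℝ → EuclideanSpace ℝ (Fin n)}
      {u : ℝ → EuclideanSpace ℝ (Fin m)}, IsClosedLoopSolution f k r μ l q (Ici 0) x₀ u₀ x u →
      (∀ t ∈ Icc 0 r, ‖x t‖ ≤ c * (‖x₀‖ + ‖u₀‖)) ∧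
        ‖u 0 - feedbackCLM k (x r)‖ ≤ c * (‖x₀‖ + ‖u₀‖) := by
  have he : 1 ≤ Real.exp ((L + 1) * r) := Real.one_le_exp (by positivity)
  have hk := norm_nonneg (feedbackCLM k)
  refine ⟨(1 + ‖feedbackCLM k‖) * Real.exp ((L + 1) * r), by nlinarith, ?_⟩
  intro μ l q x₀ u₀ x u h
  have hs : 0 ≤ ‖x₀‖ + ‖u₀‖ := by positivity
  have hx : ∀ t ∈ Icc 0 r, ‖x t‖ ≤ Real.exp ((L + 1) * r) * (‖x₀‖ + ‖u₀‖) := by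
    intro t ht
    -- The rate `L + 1` instead of `L` keeps the exponent nonzero when `L = 0`, so that a single
    -- closed form of the Gronwall bound applies.
    have h1 := norm_le_gronwallBound_of_norm_deriv_right_le (f := x) (a := 0) (b := r)
      (f' := fun s => f (x s) (u (s - r))) (δ := ‖x₀‖) (K := L + 1) (ε := L * ‖u₀‖)
      (h.continuousOn_fst.mono Icc_subset_Ici_self)
      (fun s hs => (h.x_deriv s hs.1).mono (Ici_subset_Ici.2 hs.1)) (by rw [h.x_init])
      (fun s hs => by
        have hm : s - r ∈ Icc (-r) 0 := ⟨by linarith [hs.1], by linarith [hs.2]⟩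
        have h2 := h.u_init ⟨s - r, hm⟩
        have h3 := u₀.norm_coe_le_norm ⟨s - r, hm⟩
        simp only at h2
        rw [← h2] at h3
        have h4 := mul_le_mul_of_nonneg_left h3 hL
        linarith [hgrowth (x s) (u (s - r)), norm_nonneg (x s)]) t ht
    rw [gronwallBound_of_K_ne_0 (by positivity), sub_zero] at h1
    have h2 : Real.exp ((L + 1) * t) ≤ Real.exp ((L + 1) * r) :=
      Real.exp_le_exp.2 (mul_le_mul_of_nonneg_left ht.2 (by positivity))
    have h3 : 1 ≤ Real.exp ((L + 1) * t) := Real.one_le_exp (mul_nonneg (by positivity) ht.1)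
    have h4 : L * ‖u₀‖ / (L + 1) ≤ ‖u₀‖ := by
      rw [div_le_iff₀ (by positivity)]
      linarith [norm_nonneg u₀]
    have h5 := mul_le_mul_of_nonneg_right h4 (sub_nonneg.2 h3)
    have h6 := mul_le_mul_of_nonneg_right h2 hs
    linarith [norm_nonneg u₀]
  have hxr := hx r ⟨hr, le_rfl⟩
  have hmono : Real.exp ((L + 1) * r) * (‖x₀‖ + ‖u₀‖) ≤
      (1 + ‖feedbackCLM k‖) * Real.exp ((L + 1) * r) * (‖x₀‖ + ‖u₀‖) :=
    mul_le_mul_of_nonneg_right (le_mul_of_one_le_left (by positivity) (by linarith)) hs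
  refine ⟨fun t ht => (hx t ht).trans hmono, (norm_sub_le _ _).trans ?_⟩
  have h1 := (feedbackCLM k).le_opNorm (x r)
  have h2 := mul_le_mul_of_nonneg_left hxr hk
  have h3 : u 0 = u₀ ⟨0, neg_nonpos.2 hr, le_rfl⟩ := h.u_init ⟨0, neg_nonpos.2 hr, le_rfl⟩
  have h4 := u₀.norm_coe_le_norm ⟨0, neg_nonpos.2 hr, le_rfl⟩
  rw [← h3] at h4
  have h5 := le_mul_of_one_le_left hs he
  linarith [norm_nonneg x₀]

/-- On `[t, t+r]` the state is driven by the control on `[t-r, t]`, which is exactly the history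
given to the predictor; `x(t + ·)` is thus the exact trajectory that the Picard steps approximate.
-/
theorem exists_norm_predictor_sub_solution_le (hfc : Continuous fun p : _ × _ => f p.1 p.2)
    {L : ℝ} (hL : 0 ≤ L) (hLip : ∀ x y u, ‖f x u - f y u‖ ≤ L * ‖x - y‖) (hr : 0 ≤ r)
    (hq : 0 < q) (hLr : L * r < q) :
    ∃ c, 0 ≤ c ∧ ∀ {k : Matrix (Fin n) (Fin m) ℝ} {μ : ℝ} {l : ℕ} {x₀ : EuclideanSpace ℝ (Fin n)}
      {u₀ : C(Icc (-r) 0, EuclideanSpace ℝ (Fin m))} {x : ℝ → EuclideanSpace ℝ (Fin n)}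
      {u : ℝ → EuclideanSpace ℝ (Fin m)}, IsClosedLoopSolution f k r μ l q (Ici 0) x₀ u₀ x u →
      ∀ t S, 0 ≤ t → (∀ τ ∈ Icc t (t + r), ‖x τ‖ ≤ S) →
        ‖predictor f r l q (x t) (history u t) - x (t + r)‖ ≤ c * (L * (r / q)) ^ l * S := by
  obtain ⟨c, hc, hcl⟩ := exists_norm_predictor_sub_le hfc hL hLip hr hq hLr
  refine ⟨c, hc, fun {k μ l x₀ u₀ x u} h t S ht hS => ?_⟩
  obtain ⟨x', u', hx', hu', hx, hu⟩ := h.exists_continuous_extension hr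
  have h1 := hcl l (history u' t) (fun s => x' (t + s)) S
    (hu'.comp (continuous_const.add continuous_id)) (by fun_prop) (fun s hs => ?_) (fun s hs => ?_)
  · simp only [add_zero] at h1
    rw [hx t ht, hx (t + r) (by linarith)] at h1
    rwa [predictor_congr hr hq (u := history u t) (u' := history u' t)
      (fun θ hθ => (hu (t + θ) (by linarith [hθ.1])).symm)]
  · simp only [add_zero]
    rw [hx t ht, hx _ (by linarith [hs.1]), h.x_eq_integral hfc hr ht hs.1]
    congr 1
    refine intervalIntegral.integral_congr fun τ hτ => ?_
    rw [uIcc_of_le hs.1] at hτ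
    simp only [history]
    rw [hx _ (by linarith [hτ.1]), hu _ (by linarith [hτ.1])]
    congr 2
    ring
  · rw [hx _ (by linarith [hs.1])]
    exact hS _ ⟨by linarith [hs.1], by linarith [hs.2]⟩

/-- Along a closed-loop trajectory, the deviation of the control from the feedback evaluated at the
exact prediction. -/
noncomputable def deviation (k : Matrix (Fin n) (Fin m) ℝ) (r : ℝ)
    (x : ℝ → EuclideanSpace ℝ (Fin n)) (u : ℝ → EuclideanSpace ℝ (Fin m)) (t : ℝ) :
    EuclideanSpace ℝ (Fin m) :=
  u t - feedbackCLM k (x (t + r))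

theorem IsClosedLoopSolution.continuousOn_deviation (hr : 0 ≤ r)
    (h : IsClosedLoopSolution f k r μ l q (Ici 0) x₀ u₀ x u) :
    ContinuousOn (deviation k r x u) (Ici 0) :=
  h.continuousOn_snd.sub ((feedbackCLM k).continuous.comp_continuousOn
    (h.continuousOn_fst.comp (continuous_id.add continuous_const).continuousOn
      fun t (ht : 0 ≤ t) => (add_nonneg ht hr : (0 : ℝ) ≤ t + r)))

theorem IsClosedLoopSolution.hasDerivWithinAt_deviation (hr : 0 ≤ r)
    (h : IsClosedLoopSolution f k r μ l q (Ici 0) x₀ u₀ x u) {t : ℝ} (ht : 0 ≤ t) :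
    HasDerivWithinAt (deviation k r x u)
      (feedbackCLM k (f (predictor f r l q (x t) (history u t)) (u t))
        - μ • (u t - feedbackCLM k (predictor f r l q (x t) (history u t)))
        - feedbackCLM k (f (x (t + r)) (u t))) (Ici t) t := by
  have h1 := (h.u_deriv t ht).mono (Ici_subset_Ici.2 ht)
  have h2 := h.x_deriv (t + r) (add_nonneg ht hr)
  -- Here the delay disappears: the state at time `t + r` is driven by the control at time `t`.
  rw [add_sub_cancel_right] at h2
  have h3 : HasDerivWithinAt (fun s => x (s + r)) (f (x (t + r)) (u t)) (Ici t) t := by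
    have := h2.scomp (g₁ := x) (h := fun s => s + r) t
      (((hasDerivAt_id t).add_const r).hasDerivWithinAt (s := Ici t))
      (fun s (hs : t ≤ s) => (by linarith : (0 : ℝ) ≤ s + r))
    rwa [one_smul] at this
  exact h1.sub ((feedbackCLM k).hasFDerivAt.comp_hasDerivWithinAt t h3)

/-- Variation of constants for `w`, whose linear part is `-μw` and whose forcing is at most `‖k'‖(L
+ μ)` times the prediction error. The weight `exp(lam t)` serves both results: `lam = 0` for the
`KL` estimate, a small positive `lam` for the exponential one. The condition `lam < μ` keeps the
weighted linear part decaying. -/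
theorem IsClosedLoopSolution.exp_mul_norm_deviation_le {L : ℝ} (hL : 0 ≤ L)
    (hLip : ∀ x y u, ‖f x u - f y u‖ ≤ L * ‖x - y‖) (hr : 0 ≤ r)
    (h : IsClosedLoopSolution f k r μ l q (Ici 0) x₀ u₀ x u) {ε : ℝ} (hε : 0 ≤ ε)
    (herr : ∀ t S, 0 ≤ t → (∀ τ ∈ Icc t (t + r), ‖x τ‖ ≤ S) →
        ‖predictor f r l q (x t) (history u t) - x (t + r)‖ ≤ ε * S)
    {lam : ℝ} (hlam : 0 ≤ lam) (hlamμ : lam < μ) {a t S : ℝ} (ha : 0 ≤ a) (hat : a ≤ t)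
    (hS : ∀ τ ∈ Icc a (t + r), Real.exp (lam * τ) * ‖x τ‖ ≤ S) :
    Real.exp (lam * t) * ‖deviation k r x u t‖ ≤
      Real.exp (-(μ - lam) * (t - a)) * (Real.exp (lam * a) * ‖deviation k r x u a‖) +
        ‖feedbackCLM k‖ * (L + μ) * ε / (μ - lam) * S := by
  set κ := ‖feedbackCLM k‖ with hκ
  have hκ0 : 0 ≤ κ := norm_nonneg _
  have hμ : 0 ≤ μ := hlam.trans hlamμ.le
  have hμl : 0 < μ - lam := sub_pos.2 hlamμ
  set A := κ * (L + μ) * ε / (μ - lam) * S with hA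
  have hS0 : 0 ≤ S := (by positivity : 0 ≤ Real.exp (lam * a) * ‖x a‖).trans
    (hS a ⟨le_rfl, by linarith⟩)
  have hA0 : 0 ≤ A := by positivity
  have hexp : ∀ s, HasDerivAt (fun s => Real.exp (μ * (s - a))) (Real.exp (μ * (s - a)) * μ) s :=
    fun s => by simpa using (((hasDerivAt_id s).sub_const a).const_mul μ).exp
  -- The comparison function for `exp(μ(s-a)) w(s)`: its derivative equals the bound on the forcing,
  -- and it starts above `‖w(a)‖` because `A ≥ 0`.
  have hB : ∀ s, HasDerivAt
      (fun s => ‖deviation k r x u a‖ + A * Real.exp (-(lam * a)) * Real.exp ((μ - lam) * (s - a)))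
      (A * Real.exp (-(lam * a)) * (Real.exp ((μ - lam) * (s - a)) * (μ - lam))) s := fun s => by
    have := ((((hasDerivAt_id s).sub_const a).const_mul (μ - lam)).exp.const_mul
      (A * Real.exp (-(lam * a)))).const_add ‖deviation k r x u a‖
    simpa using this
  have key := image_norm_le_of_norm_deriv_right_le_deriv_boundary (a := a) (b := t)
    (f := fun s => Real.exp (μ * (s - a)) • deviation k r x u s)
    (f' := fun s => Real.exp (μ * (s - a)) •
      (feedbackCLM k (f (predictor f r l q (x s) (history u s)) (u s))
        - μ • (u s - feedbackCLM k (predictor f r l q (x s) (history u s)))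
        - feedbackCLM k (f (x (s + r)) (u s))) +
      (Real.exp (μ * (s - a)) * μ) • deviation k r x u s)
    (ContinuousOn.smul (f := fun s => Real.exp (μ * (s - a))) (g := deviation k r x u)
      (by fun_prop) ((h.continuousOn_deviation hr).mono fun s hs => ha.trans hs.1))
    (fun s hs => ((hexp s).hasDerivWithinAt).smul
      (h.hasDerivWithinAt_deviation hr (ha.trans hs.1)))
    (by simp [hA0, (Real.exp_pos _).le, mul_nonneg]) hB (fun s hs => ?_) ⟨hat, le_rfl⟩
  · rw [norm_smul, Real.norm_of_nonneg (Real.exp_pos _).le] at key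
    have h1 := mul_le_mul_of_nonneg_left key (Real.exp_pos (lam * t - μ * (t - a))).le
    rw [← mul_assoc, ← Real.exp_add, sub_add_cancel] at h1
    refine h1.trans (le_of_eq ?_)
    rw [mul_add]
    congr 1
    · rw [← mul_assoc, ← Real.exp_add]
      congr 2
      ring
    · rw [show Real.exp (lam * t - μ * (t - a)) * (A * Real.exp (-(lam * a)) *
        Real.exp ((μ - lam) * (t - a))) = A * (Real.exp (lam * t - μ * (t - a)) *
        Real.exp (-(lam * a)) * Real.exp ((μ - lam) * (t - a))) by ring, ← Real.exp_add,
        ← Real.exp_add]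
      rw [show lam * t - μ * (t - a) + -(lam * a) + (μ - lam) * (t - a) = 0 by ring,
        Real.exp_zero, mul_one]
  · have hs0 : 0 ≤ s := ha.trans hs.1
    -- The weight increases, so on the window `[s, s + r]` the weighted bound `S` gives `‖x τ‖ ≤ S
    -- exp(-lam s)`.
    have e0 := herr s (S * Real.exp (-(lam * s))) hs0 fun τ hτ => by
      have h1 := hS τ ⟨hs.1.trans hτ.1, hτ.2.trans (by linarith [hs.2])⟩
      have h2 : Real.exp (lam * s) * ‖x τ‖ ≤ S := (mul_le_mul_of_nonneg_right
        (Real.exp_le_exp.2 (mul_le_mul_of_nonneg_left hτ.1 hlam)) (norm_nonneg _)).trans h1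
      rw [Real.exp_neg, ← div_eq_mul_inv, le_div_iff₀ (Real.exp_pos _), mul_comm]
      exact h2
    set p := predictor f r l q (x s) (history u s)
    -- The integrating factor removes `-μw`; only terms that vanish for an exact prediction remain.
    have e1 : Real.exp (μ * (s - a)) • (feedbackCLM k (f p (u s))
        - μ • (u s - feedbackCLM k p) - feedbackCLM k (f (x (s + r)) (u s))) +
        (Real.exp (μ * (s - a)) * μ) • deviation k r x u s =
        Real.exp (μ * (s - a)) • (feedbackCLM k (f p (u s) - f (x (s + r)) (u s)) +
          μ • feedbackCLM k (p - x (s + r))) := by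
      rw [deviation, map_sub, map_sub]
      module
    rw [e1, norm_smul, Real.norm_of_nonneg (Real.exp_pos _).le]
    have e2 : ‖feedbackCLM k (f p (u s) - f (x (s + r)) (u s))‖ ≤
        κ * (L * (ε * (S * Real.exp (-(lam * s))))) :=
      ((feedbackCLM k).le_opNorm _).trans (mul_le_mul_of_nonneg_left
        ((hLip _ _ _).trans (mul_le_mul_of_nonneg_left e0 hL)) hκ0)
    have e3 : ‖μ • feedbackCLM k (p - x (s + r))‖ ≤
        μ * (κ * (ε * (S * Real.exp (-(lam * s))))) := by
      rw [norm_smul, Real.norm_of_nonneg hμ]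
      exact mul_le_mul_of_nonneg_left (((feedbackCLM k).le_opNorm _).trans
        (mul_le_mul_of_nonneg_left e0 hκ0)) hμ
    refine (mul_le_mul_of_nonneg_left ((norm_add_le _ _).trans (add_le_add e2 e3))
      (Real.exp_pos _).le).trans (le_of_eq ?_)
    have e4 : Real.exp (μ * (s - a)) * Real.exp (-(lam * s)) =
        Real.exp (-(lam * a)) * Real.exp ((μ - lam) * (s - a)) := by
      rw [← Real.exp_add, ← Real.exp_add]
      congr 1
      ring
    have e5 : A * (μ - lam) = κ * (L + μ) * ε * S := by
      rw [hA]
      field_simp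
    calc _ = κ * (L + μ) * ε * S * (Real.exp (μ * (s - a)) * Real.exp (-(lam * s))) := by ring
      _ = _ := by rw [e4, ← e5]; ring

theorem IsClosedLoopSolution.isInput_deviation (hr : 0 ≤ r)
    (h : IsClosedLoopSolution f k r μ l q (Ici 0) x₀ u₀ x u) {a : ℝ} (ha : 0 ≤ a) :
    IsInput fun t => deviation k r x u (a + t) := by
  intro t
  have hc : ContinuousOn (fun t => deviation k r x u (a + t)) (Icc 0 t) :=
    (h.continuousOn_deviation hr).comp (continuous_const.add continuous_id).continuousOn
      fun s hs => (add_nonneg ha hs.1 : (0 : ℝ) ≤ a + s)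
  obtain ⟨C, hC⟩ := isCompact_Icc.exists_bound_of_continuousOn hc
  exact memLp_top_of_bound (hc.aestronglyMeasurable measurableSet_Icc) C
    ((ae_restrict_iff' measurableSet_Icc).2 (Eventually.of_forall hC))

theorem IsClosedLoopSolution.isPerturbedSolution (hfc : Continuous fun p : _ × _ => f p.1 p.2)
    (hr : 0 ≤ r) (h : IsClosedLoopSolution f k r μ l q (Ici 0) x₀ u₀ x u) {a : ℝ} (ha : 0 ≤ a) :
    IsPerturbedSolution f k (x (a + r)) (fun t => deviation k r x u (a + t))
      (fun t => x (a + r + t)) where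
  continuousOn := h.continuousOn_fst.comp (continuous_const.add continuous_id).continuousOn
    fun s (hs : 0 ≤ s) => (by positivity : (0 : ℝ) ≤ a + r + s)
  integral_eq t ht := by
    rw [h.x_eq_integral hfc hr (add_nonneg ha hr) ht]
    congr 1
    refine intervalIntegral.integral_congr fun s _ => ?_
    simp only [linFeedback_eq, deviation]
    rw [show a + s + r = a + r + s by ring, show a + r + s - r = a + s by ring, add_sub_cancel]

end Trajectory

/-! ### Small-gain bounds and uniform attraction. -/

section SmallGain

/-- Going once around the loop bounds the weighted maximum `S` of `X` by data plus `exp(lam r) γκ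
S`, and the last term is at most `S/4`. Since `S` is a maximum over a compact interval it is finite
and can be absorbed; no boundedness need be known beforehand. -/
theorem smallGain_le {X W : ℝ → ℝ} (hX : ContinuousOn X (Ici 0)) {r lam N a κ γ : ℝ} (hr : 0 ≤ r)
    (hlam : 0 ≤ lam) (hN : 0 ≤ N) (ha : 0 ≤ a) (hκ : 0 ≤ κ) (hγ : 0 ≤ γ)
    (hX0 : ∀ t, 0 ≤ X t) (hinit : ∀ t ∈ Icc 0 r, X t ≤ N)
    (hXW : ∀ t B, 0 ≤ t → (∀ τ ∈ Icc 0 t, Real.exp (lam * τ) * W τ ≤ B) →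
      Real.exp (lam * t) * X (t + r) ≤ max a (γ * B))
    (hWX : ∀ t S, 0 ≤ t → (∀ τ ∈ Icc 0 (t + r), Real.exp (lam * τ) * X τ ≤ S) →
      Real.exp (lam * t) * W t ≤ N + κ * S)
    (hsmall : Real.exp (lam * r) * ((1 + γ) * κ) ≤ 1 / 4) {t : ℝ} (ht : 0 ≤ t) :
    Real.exp (lam * t) * X t ≤ 2 * Real.exp (lam * r) * (a + (1 + γ) * N) ∧
      Real.exp (lam * t) * W t ≤ 2 * Real.exp (lam * r) * (a + (1 + γ) * N) := by
  set e := Real.exp (lam * r) with he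
  have he1 : 1 ≤ e := Real.one_le_exp (by positivity)
  -- The interval reaches to `t + r` because the bound on `W` at time `t` looks ahead by `r`. The
  -- loop still closes: bounding `X` at `T` needs `W` only up to `T - r`, hence `X` only up to `T`.
  obtain ⟨T, hT, hmax⟩ := isCompact_Icc.exists_isMaxOn (nonempty_Icc.2 (add_nonneg ht hr))
    (f := fun t => Real.exp (lam * t) * X t)
    (ContinuousOn.mul (by fun_prop) (hX.mono Icc_subset_Ici_self))
  set S := Real.exp (lam * T) * X T with hS
  have hS0 : 0 ≤ S := mul_nonneg (Real.exp_pos _).le (hX0 _)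
  have hle : ∀ τ ∈ Icc 0 (t + r), Real.exp (lam * τ) * X τ ≤ S := fun τ hτ => hmax hτ
  have hW : ∀ τ ∈ Icc 0 t, Real.exp (lam * τ) * W τ ≤ N + κ * S := fun τ hτ =>
    hWX τ S hτ.1 fun s hs => hle s ⟨hs.1, by linarith [hs.2, hτ.2]⟩
  have hκS : 0 ≤ κ * S := by positivity
  have hγN : 0 ≤ γ * N := by positivity
  have hb0 : 0 ≤ a + (1 + γ) * N := by positivity
  have hγκ : e * (γ * κ) * S ≤ 1 / 4 * S := by
    refine mul_le_mul_of_nonneg_right (le_trans ?_ hsmall) hS0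
    exact mul_le_mul_of_nonneg_left (by linarith) (by linarith)
  have hSb : S ≤ 2 * e * (a + (1 + γ) * N) := by
    rcases le_total T r with h | h
    · have h1 : S ≤ e * N := by
        have := hinit T ⟨hT.1, h⟩
        exact mul_le_mul (Real.exp_le_exp.2 (mul_le_mul_of_nonneg_left h hlam)) this (hX0 _)
          (by positivity)
      have h2 := mul_le_mul_of_nonneg_left (show N ≤ a + (1 + γ) * N by linarith)
        (show 0 ≤ e by linarith)
      have h3 : 0 ≤ e * (a + (1 + γ) * N) := by positivity
      linarith
    · have h1 := hXW (T - r) (N + κ * S) (by linarith) fun τ hτ =>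
        hW τ ⟨hτ.1, by linarith [hτ.2, hT.2]⟩
      rw [sub_add_cancel] at h1
      have h2 : S = e * (Real.exp (lam * (T - r)) * X T) := by
        rw [he, ← mul_assoc, ← Real.exp_add, hS]
        congr 2
        ring
      have h3 : max a (γ * (N + κ * S)) ≤ a + γ * (N + κ * S) :=
        max_le (by linarith [show 0 ≤ γ * (N + κ * S) by positivity]) (by linarith)
      have h4 := mul_le_mul_of_nonneg_left (h1.trans h3) (show 0 ≤ e by linarith)
      rw [← h2] at h4
      have h5 : 0 ≤ e * a := by positivity
      have h6 : 0 ≤ e * N := by positivity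
      have h7 : 0 ≤ e * (γ * N) := by positivity
      linarith
  refine ⟨(hle t ⟨ht, by linarith⟩).trans hSb, (hW t ⟨ht, le_rfl⟩).trans ?_⟩
  have h8 : κ ≤ 1 / 4 := by
    refine le_trans ?_ hsmall
    have : 0 ≤ γ * κ := by positivity
    nlinarith
  have h9 : κ * S ≤ 1 / 4 * (2 * e * (a + (1 + γ) * N)) :=
    mul_le_mul h8 hSb hS0 (by norm_num)
  have h10 : a + (1 + γ) * N ≤ e * (a + (1 + γ) * N) := le_mul_of_one_le_left hb0 he1
  linarith

/-- Interconnection of two nonnegative signals: `X`, delayed by `r`, is input-to-state stable with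
respect to `W`, and `W` decays exponentially up to a perturbation by `X` of gain `κ`. -/
structure IsInterconnection (σ : ℝ → ℝ → ℝ) (γ μ κ r : ℝ) (X W : ℝ → ℝ) : Prop where
  fst_nonneg : ∀ t, 0 ≤ X t
  fst_le : ∀ a t B, 0 ≤ a → a ≤ t → (∀ τ ∈ Icc a t, W τ ≤ B) →
    X (t + r) ≤ max (σ (X (a + r)) (t - a)) (γ * B)
  snd_le : ∀ a t S, 0 ≤ a → a ≤ t → (∀ τ ∈ Icc a (t + r), X τ ≤ S) →
    W t ≤ Real.exp (-μ * (t - a)) * W a + κ * S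

/-- First the transient of `W` dies out, leaving `W` at most `A/(2(1+γ))` by the small-gain
condition. Restarting the estimate of `X` from there, the gain term is below `A/2`, and `σ(A, ·)`
falls below `A/2` after a further wait. Both waiting times are chosen before the signals, so they
are uniform. -/
theorem exists_halving_time {σ : ℝ → ℝ → ℝ} (hσ : IsKL σ) {γ μ κ r : ℝ} (hγ : 0 ≤ γ) (hμ : 0 < μ)
    (hr : 0 ≤ r) (hsmall : (1 + γ) * κ ≤ 1 / 4) {A : ℝ} (hA : 0 < A) :
    ∃ T, 0 ≤ T ∧ ∀ X W, IsInterconnection σ γ μ κ r X W → ∀ a, 0 ≤ a →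
      (∀ t, a ≤ t → X t ≤ A ∧ W t ≤ A) → ∀ t, a + T ≤ t → X t ≤ A / 2 ∧ W t ≤ A / 2 := by
  have hγ1 : 0 < 1 + γ := by positivity
  have hlim : Tendsto (fun t : ℝ => Real.exp (-μ * t)) atTop (𝓝 0) := by
    have := Real.tendsto_exp_neg_atTop_nhds_zero.comp (tendsto_id.const_mul_atTop hμ)
    refine this.congr fun t => ?_
    simp
  obtain ⟨T₁, hT₁, hT₁0⟩ := ((hlim.eventually_le_const
    (show (0 : ℝ) < 1 / (4 * (1 + γ)) by positivity)).and (eventually_ge_atTop 0)).exists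
  obtain ⟨T₂, hT₂, hT₂0⟩ := (((hσ.tendsto A hA.le).eventually_le_const
    (show (0 : ℝ) < A / 2 by positivity)).and (eventually_ge_atTop 0)).exists
  -- The extra `r` is the delay with which `W` acts on `X`.
  refine ⟨T₁ + T₂ + r, by positivity, fun X W h a ha hbd => ?_⟩
  have hγ2 : 1 / (4 * (1 + γ)) * A + κ * A ≤ A / 2 / (1 + γ) := by
    rw [le_div_iff₀ hγ1]
    have : 1 / (4 * (1 + γ)) * A * (1 + γ) = A / 4 := by field_simp
    nlinarith
  have hW : ∀ t, a + T₁ ≤ t → W t ≤ A / 2 / (1 + γ) := fun t ht => by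
    refine (h.snd_le a t A ha (by linarith) fun τ hτ => (hbd τ hτ.1).1).trans
      (le_trans ?_ hγ2)
    have h1 : Real.exp (-μ * (t - a)) ≤ 1 / (4 * (1 + γ)) :=
      (Real.exp_le_exp.2 (by nlinarith)).trans hT₁
    have h2 : Real.exp (-μ * (t - a)) * W a ≤ Real.exp (-μ * (t - a)) * A :=
      mul_le_mul_of_nonneg_left (hbd a le_rfl).2 (Real.exp_pos _).le
    have h3 := mul_le_mul_of_nonneg_right h1 hA.le
    linarith
  intro t ht
  constructor
  · have h1 := h.fst_le (a + T₁) (t - r) (A / 2 / (1 + γ)) (by positivity) (by linarith)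
      fun τ hτ => hW τ hτ.1
    rw [sub_add_cancel] at h1
    refine h1.trans (max_le ?_ ?_)
    · have hXA := (hbd (a + T₁ + r) (by linarith)).1
      have h2 : σ (X (a + T₁ + r)) (t - r - (a + T₁)) ≤ σ A (t - r - (a + T₁)) :=
        (hσ.strictMono _ (by linarith)).monotoneOn (h.fst_nonneg _) hA.le hXA
      have h3 : σ A (t - r - (a + T₁)) ≤ σ A T₂ :=
        hσ.antitone A hA.le hT₂0 (by simp only [mem_Ici]; linarith) (by linarith)
      exact h2.trans (h3.trans hT₂)
    · rw [← mul_div_assoc, div_le_iff₀ hγ1]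
      nlinarith
  · refine (hW t (by linarith)).trans (div_le_self (by positivity) (by linarith))

theorem exists_attraction_time {σ : ℝ → ℝ → ℝ} (hσ : IsKL σ) {γ μ κ r : ℝ} (hγ : 0 ≤ γ)
    (hμ : 0 < μ) (hr : 0 ≤ r) (hsmall : (1 + γ) * κ ≤ 1 / 4) {A η : ℝ} (hA : 0 < A) (hη : 0 < η) :
    ∃ T, 0 ≤ T ∧ ∀ X W, IsInterconnection σ γ μ κ r X W →
      (∀ t, 0 ≤ t → X t ≤ A ∧ W t ≤ A) → ∀ t, T ≤ t → X t ≤ η ∧ W t ≤ η := by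
  have hj : ∀ j : ℕ, ∃ T, 0 ≤ T ∧ ∀ X W, IsInterconnection σ γ μ κ r X W →
      (∀ t, 0 ≤ t → X t ≤ A ∧ W t ≤ A) → ∀ t, T ≤ t → X t ≤ A / 2 ^ j ∧ W t ≤ A / 2 ^ j := by
    intro j
    induction j with
    | zero => exact ⟨0, le_rfl, fun X W _ h t ht => by simpa using h t ht⟩
    | succ j ih =>
      obtain ⟨T, hT, h⟩ := ih
      obtain ⟨T', hT', h'⟩ := exists_halving_time hσ hγ hμ hr hsmall
        (show 0 < A / 2 ^ j by positivity)
      refine ⟨T + T', by positivity, fun X W hXW hbd t ht => ?_⟩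
      have := h' X W hXW T hT (h X W hXW hbd) t ht
      rwa [div_div, ← pow_succ] at this
  obtain ⟨j, hj'⟩ := exists_pow_lt_of_lt_one (show 0 < η / A by positivity)
    (show (1 / 2 : ℝ) < 1 by norm_num)
  obtain ⟨T, hT, h⟩ := hj j
  have hle : A / 2 ^ j ≤ η := by
    rw [lt_div_iff₀ hA] at hj'
    rw [div_eq_mul_inv, ← inv_pow, mul_comm]
    simpa using hj'.le
  exact ⟨T, hT, fun X W hXW hbd t ht =>
    ⟨(h X W hXW hbd t ht).1.trans hle, (h X W hXW hbd t ht).2.trans hle⟩⟩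

end SmallGain

/-! ### From boundedness and attraction to a class `KL` bound. -/

section KLMajorant

theorem abs_integral_window_sub_le {h : ℝ → ℝ} (hint : ∀ a b, IntervalIntegrable h volume a b)
    {P R a b : ℝ} (hP : ∀ τ ≤ R + 1, |h τ| ≤ P) (ha : a ≤ R) (hb : b ≤ R) :
    |(∫ τ in a..a + 1, h τ) - ∫ τ in b..b + 1, h τ| ≤ 2 * P * |a - b| := by
  have hsub : (∫ τ in a..a + 1, h τ) - ∫ τ in b..b + 1, h τ =
      (∫ τ in (b + 1)..(a + 1), h τ) - ∫ τ in b..a, h τ := by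
    rw [sub_eq_sub_iff_add_eq_add]
    have h1 := intervalIntegral.integral_add_adjacent_intervals (hint b a) (hint a (a + 1))
    have h2 := intervalIntegral.integral_add_adjacent_intervals (hint b (b + 1))
      (hint (b + 1) (a + 1))
    linarith
  have hbound : ∀ c d, c ≤ R + 1 → d ≤ R + 1 → |∫ τ in c..d, h τ| ≤ P * |d - c| :=
    fun c d hc hd => by
      rw [← Real.norm_eq_abs]
      exact intervalIntegral.norm_integral_le_of_norm_le_const fun τ hτ =>
        hP τ ((mem_Ioc.1 hτ).2.trans (max_le hc hd))
  rw [hsub]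
  have h1 := hbound (b + 1) (a + 1) (by linarith) (by linarith)
  have h2 := hbound b a (by linarith) (by linarith)
  rw [add_sub_add_right_eq_sub] at h1
  have h3 := abs_sub (∫ τ in (b + 1)..(a + 1), h τ) (∫ τ in b..a, h τ)
  linarith

/-- A function that increases in its first and decreases in its second argument has a continuous
majorant of the same kind. -/
theorem exists_continuous_majorant {b : ℝ → ℝ → ℝ} (hb0 : ∀ s t, 0 ≤ b s t)
    (hbm : ∀ t, Monotone fun s => b s t) (hba : ∀ s, Antitone (b s))
    (hbc : ∀ s t, t ≤ 0 → b s t = b s 0) (hbl : ∀ s, Tendsto (b s) atTop (𝓝 0)) :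
    ∃ g : ℝ → ℝ → ℝ, Continuous (fun p : ℝ × ℝ => g p.1 p.2) ∧ (∀ s t, b s t ≤ g s t) ∧
      (∀ t, Monotone fun s => g s t) ∧ (∀ s, Antitone (g s)) ∧
      ∀ s, Tendsto (g s) atTop (𝓝 0) := by
  have hbint : ∀ s c d, IntervalIntegrable (b s) volume c d := fun s c d =>
    (hba s).intervalIntegrable
  have hbP : ∀ s t, b s t ≤ b s 0 := fun s t => by
    rcases le_total t 0 with h | h
    · exact (hbc s t h).le
    · exact hba s h
  -- Averaging over the past unit interval keeps the majorant property because `b s` decreases, and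
  -- makes it Lipschitz in `t`. Monotone functions are integrable, so no regularity of `b` is
  -- needed.
  set C : ℝ → ℝ → ℝ := fun s t => ∫ τ in (t - 1)..t, b s τ with hC
  have hconst : ∀ c d A : ℝ, d = c + 1 → ∫ _τ in c..d, A = A := fun c d A h => by simp [h]
  have hCm : ∀ t, Monotone fun s => C s t := fun t s s' hs =>
    intervalIntegral.integral_mono_on (by linarith) (hbint _ _ _) (hbint _ _ _)
      fun τ _ => hbm τ hs
  have hCge : ∀ s t, b s t ≤ C s t := fun s t => by
    have := intervalIntegral.integral_mono_on (a := t - 1) (b := t) (by linarith)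
      intervalIntegrable_const (hbint s _ _) (f := fun _ => b s t) fun τ hτ => hba s hτ.2
    rwa [hconst _ _ _ (by ring)] at this
  have hCle : ∀ s t, C s t ≤ b s (t - 1) := fun s t => by
    have := intervalIntegral.integral_mono_on (a := t - 1) (b := t) (by linarith)
      (hbint s _ _) intervalIntegrable_const (g := fun _ => b s (t - 1)) fun τ hτ => hba s hτ.1
    rwa [hconst _ _ _ (by ring)] at this
  have hC0 : ∀ s t, 0 ≤ C s t := fun s t => (hb0 s t).trans (hCge s t)
  have hCshift : ∀ s t, C s t = ∫ τ in (0 : ℝ)..1, b s (t - 1 + τ) := fun s t => by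
    rw [intervalIntegral.integral_comp_add_left (fun τ => b s τ), hC]
    simp
  have hCa : ∀ s, Antitone (C s) := fun s t t' ht => by
    rw [hCshift, hCshift]
    have hi : ∀ t, IntervalIntegrable (fun τ => b s (t - 1 + τ)) volume 0 1 := fun t =>
      Antitone.intervalIntegrable fun τ τ' hτ => hba s (by linarith)
    exact intervalIntegral.integral_mono_on zero_le_one (hi _) (hi _)
      fun τ _ => hba s (by linarith)
  have hCint : ∀ t c d, IntervalIntegrable (fun s => C s t) volume c d := fun t c d =>
    (hCm t).intervalIntegrable
  have hCt : ∀ s t t', |C s t - C s t'| ≤ 2 * b s 0 * |t - t'| := fun s t t' => by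
    have := abs_integral_window_sub_le (hbint s) (P := b s 0) (R := max (t - 1) (t' - 1))
      (a := t - 1) (b := t' - 1) (fun τ _ => by rw [abs_of_nonneg (hb0 s τ)]; exact hbP s τ)
      (le_max_left _ _) (le_max_right _ _)
    simpa [hC] using this
  -- In the increasing variable the average runs over the following unit interval. The Lipschitz
  -- bounds in `s` and in `t` are uniform for `s` bounded above, which gives joint continuity.
  set g : ℝ → ℝ → ℝ := fun s t => ∫ ξ in s..s + 1, C ξ t with hg
  have hgshift : ∀ s t, g s t = ∫ ξ in (0 : ℝ)..1, C (s + ξ) t := fun s t => by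
    rw [intervalIntegral.integral_comp_add_left (fun ξ => C ξ t), add_zero]
  have hgge : ∀ s t, C s t ≤ g s t := fun s t => by
    have := intervalIntegral.integral_mono_on (a := s) (b := s + 1) (by linarith)
      intervalIntegrable_const (hCint t _ _) (f := fun _ => C s t) fun ξ hξ => hCm t hξ.1
    rwa [hconst _ _ _ rfl] at this
  have hgle : ∀ s t, g s t ≤ C (s + 1) t := fun s t => by
    have := intervalIntegral.integral_mono_on (a := s) (b := s + 1) (by linarith)
      (hCint t _ _) intervalIntegrable_const (g := fun _ => C (s + 1) t) fun ξ hξ => hCm t hξ.2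
    rwa [hconst _ _ _ rfl] at this
  have hgs : ∀ R t s s', s ≤ R → s' ≤ R → |g s t - g s' t| ≤ 2 * b (R + 1) 0 * |s - s'| :=
    fun R t s s' hs hs' => abs_integral_window_sub_le (hCint t) (P := b (R + 1) 0) (R := R)
      (fun ξ hξ => by
        rw [abs_of_nonneg (hC0 ξ t)]
        exact (hCle ξ t).trans ((hbP _ _).trans (hbm 0 hξ))) hs hs'
  have hgt : ∀ s t t', |g s t - g s t'| ≤ 2 * b (s + 1) 0 * |t - t'| := fun s t t' => by
    rw [hg]
    simp only
    rw [← intervalIntegral.integral_sub (hCint t _ _) (hCint t' _ _)]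
    have := intervalIntegral.norm_integral_le_of_norm_le_const (a := s) (b := s + 1)
      (f := fun ξ => C ξ t - C ξ t') (C := 2 * b (s + 1) 0 * |t - t'|) fun ξ hξ => by
        rw [uIoc_of_le (by linarith)] at hξ
        refine (hCt ξ t t').trans (mul_le_mul_of_nonneg_right ?_ (abs_nonneg _))
        linarith [hbm 0 hξ.2]
    simpa using this
  refine ⟨g, ?_, fun s t => (hCge s t).trans (hgge s t), fun t s s' hs => ?_,
    fun s t t' ht => ?_, fun s => ?_⟩
  · rw [continuous_iff_continuousAt]
    rintro ⟨s₀, t₀⟩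
    rw [ContinuousAt, tendsto_iff_dist_tendsto_zero]
    have hlim : Tendsto (fun p : ℝ × ℝ => 2 * b (s₀ + 1 + 1) 0 * |p.1 - s₀| +
        2 * b (s₀ + 1) 0 * |p.2 - t₀|) (𝓝 (s₀, t₀)) (𝓝 0) := by
      have : Continuous fun p : ℝ × ℝ => 2 * b (s₀ + 1 + 1) 0 * |p.1 - s₀| +
        2 * b (s₀ + 1) 0 * |p.2 - t₀| := by fun_prop
      simpa using this.tendsto (s₀, t₀)
    refine squeeze_zero' (Eventually.of_forall fun _ => dist_nonneg) ?_ hlim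
    filter_upwards [continuous_fst.continuousAt.eventually_lt_const
      (show (s₀, t₀).1 < s₀ + 1 by simp)] with p hp
    rw [Real.dist_eq]
    have h1 := hgs (s₀ + 1) p.2 p.1 s₀ hp.le (by linarith)
    have h2 := hgt s₀ p.2 t₀
    have h3 := abs_sub_le (g p.1 p.2) (g s₀ p.2) (g s₀ t₀)
    linarith
  · simp only
    rw [hgshift, hgshift]
    have hi : ∀ s, IntervalIntegrable (fun ξ => C (s + ξ) t) volume 0 1 := fun s =>
      Monotone.intervalIntegrable fun ξ ξ' hξ => hCm t (by linarith)
    exact intervalIntegral.integral_mono_on zero_le_one (hi _) (hi _)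
      fun τ _ => hCm t (by linarith)
  · exact intervalIntegral.integral_mono_on (by linarith) (hCint _ _ _) (hCint _ _ _)
      fun ξ _ => hCa ξ ht
  · refine squeeze_zero (fun t => (hC0 s t).trans (hgge s t))
      (fun t => (hgle s t).trans (hCle (s + 1) t)) ?_
    exact (hbl (s + 1)).comp (tendsto_atTop_add_const_right _ (-1) tendsto_id)

/-- Uniform boundedness by a class `K` function together with uniform attractivity give a
class `KL` estimate. -/
theorem exists_isKL_majorant {ι : Type*} {N : ι → ℝ} {V : ι → ℝ → ℝ} {α : ℝ → ℝ}
    (hαc : ContinuousOn α (Ici 0)) (hαm : StrictMonoOn α (Ici 0)) (hα0 : α 0 = 0)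
    (hN : ∀ i, 0 ≤ N i) (hV : ∀ i t, 0 ≤ V i t) (hVα : ∀ i t, 0 ≤ t → V i t ≤ α (N i))
    (hatt : ∀ R η, 0 < η → ∃ T, ∀ i, N i ≤ R → ∀ t, T ≤ t → V i t ≤ η) :
    ∃ σ : ℝ → ℝ → ℝ, IsKL σ ∧ ∀ i t, 0 ≤ t → V i t ≤ σ (N i) t := by
  have hαnn : ∀ s, 0 ≤ s → 0 ≤ α s := fun s hs => by
    rw [← hα0]
    exact hαm.monotoneOn (mem_Ici.2 le_rfl) hs hs
  -- Inserting `0` keeps the set nonempty when no index satisfies `N i ≤ s`, and makes the supremum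
  -- nonnegative.
  set A : ℝ → ℝ → Set ℝ := fun s t =>
    insert 0 {y | ∃ i t', N i ≤ s ∧ 0 ≤ t' ∧ t ≤ t' ∧ V i t' = y} with hA
  have hAbdd : ∀ s t, BddAbove (A s t) := fun s t => by
    refine ⟨α (max s 0), ?_⟩
    rintro y (rfl | ⟨i, t', hi, ht', -, rfl⟩)
    · exact hαnn _ (le_max_right _ _)
    · exact (hVα i t' ht').trans (hαm.monotoneOn (hN i) (mem_Ici.2 (le_max_right _ _))
        (hi.trans (le_max_left _ _)))
  have hAne : ∀ s t, (A s t).Nonempty := fun s t => ⟨0, mem_insert _ _⟩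
  -- The square root splits the estimate: `V = √V · √V`, with one factor bounded by `√α`, which
  -- vanishes at zero and increases strictly, and the other by `b`, which tends to zero in time.
  set b : ℝ → ℝ → ℝ := fun s t => √(sSup (A s t)) with hb
  have hbl : ∀ s, Tendsto (b s) atTop (𝓝 0) := fun s => by
    have h1 : Tendsto (fun t => sSup (A s t)) atTop (𝓝 0) := by
      rw [Metric.tendsto_atTop]
      intro ε hε
      obtain ⟨T, hT⟩ := hatt s (ε / 2) (by positivity)
      refine ⟨T, fun t ht => ?_⟩
      have h0 : 0 ≤ sSup (A s t) := le_csSup (hAbdd s t) (mem_insert _ _)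
      rw [Real.dist_eq, sub_zero, abs_of_nonneg h0]
      refine (csSup_le (hAne s t) ?_).trans_lt (half_lt_self hε)
      rintro y (rfl | ⟨i, t', hi, -, htt', rfl⟩)
      · positivity
      · exact hT i hi t' (ht.trans htt')
    have h2 := (Real.continuous_sqrt.tendsto 0).comp h1
    rwa [Real.sqrt_zero] at h2
  obtain ⟨g, hgc, hbg, hgm, hga, hgl⟩ := exists_continuous_majorant (b := b)
    (fun s t => Real.sqrt_nonneg _)
    (fun t s s' hs => Real.sqrt_le_sqrt (csSup_le_csSup (hAbdd _ _) (hAne _ _)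
      (insert_subset_insert fun y ⟨i, t', hi, h⟩ => ⟨i, t', hi.trans hs, h⟩)))
    (fun s t t' ht => Real.sqrt_le_sqrt (csSup_le_csSup (hAbdd _ _) (hAne _ _)
      (insert_subset_insert fun y ⟨i, t'', hi, h0, h1, h2⟩ => ⟨i, t'', hi, h0, ht.trans h1, h2⟩)))
    (fun s t ht => by
      have : A s t = A s 0 := congrArg (insert 0) (ext fun y =>
        ⟨fun ⟨i, t', hi, h0, _, h2⟩ => ⟨i, t', hi, h0, h0, h2⟩,
          fun ⟨i, t', hi, h0, _, h2⟩ => ⟨i, t', hi, h0, ht.trans h0, h2⟩⟩)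
      simp only [hb, this]) hbl
  have hg0 : ∀ s t, 0 ≤ g s t := fun s t => (Real.sqrt_nonneg _).trans (hbg s t)
  have hpos : ∀ s t, 0 < g s t + Real.exp (-t) := fun s t =>
    add_pos_of_nonneg_of_pos (hg0 s t) (Real.exp_pos _)
  -- The summand `exp(-t)` makes the second factor positive, so that the strict growth of `√α`
  -- passes to the product even where `g` vanishes.
  refine ⟨fun s t => √(α s) * (g s t + Real.exp (-t)), ⟨?_, fun t _ => by simp [hα0],
    fun t ht s hs s' hs' hss => ?_, fun s hs t ht t' ht' htt => ?_, fun s hs => ?_⟩,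
    fun i t ht => ?_⟩
  · refine ContinuousOn.mul ?_ ?_
    · exact Real.continuous_sqrt.comp_continuousOn (hαc.comp continuousOn_fst fun p hp => hp.1)
    · exact (hgc.add (Real.continuous_exp.comp continuous_snd.neg)).continuousOn
  · have h1 : √(α s) < √(α s') := Real.sqrt_lt_sqrt (hαnn s hs) (hαm hs hs' hss)
    have h2 : g s t + Real.exp (-t) ≤ g s' t + Real.exp (-t) := by
      linarith [hgm t hss.le]
    exact mul_lt_mul h1 h2 (hpos s t) (Real.sqrt_nonneg _)
  · refine mul_le_mul_of_nonneg_left ?_ (Real.sqrt_nonneg _)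
    exact add_le_add (hga s htt) (Real.exp_le_exp.2 (by linarith))
  · have := ((hgl s).add Real.tendsto_exp_neg_atTop_nhds_zero).const_mul (√(α s))
    simpa using this
  · have h1 : √(V i t) ≤ √(α (N i)) := Real.sqrt_le_sqrt (hVα i t ht)
    have h2 : √(V i t) ≤ b (N i) t := Real.sqrt_le_sqrt (le_csSup (hAbdd _ _)
      (mem_insert_of_mem _ ⟨i, t, le_rfl, ht, le_rfl, rfl⟩))
    have h3 : b (N i) t ≤ g (N i) t + Real.exp (-t) := by
      linarith [hbg (N i) t, Real.exp_pos (-t)]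
    calc V i t = √(V i t) * √(V i t) := (Real.mul_self_sqrt (hV i t)).symm
      _ ≤ _ := mul_le_mul h1 (h2.trans h3) (Real.sqrt_nonneg _) (Real.sqrt_nonneg _)

end KLMajorant

/-! ### Choice of `l` and the two stability estimates. -/

section Stability

variable {n m : ℕ}
  {f : EuclideanSpace ℝ (Fin n) → EuclideanSpace ℝ (Fin m) → EuclideanSpace ℝ (Fin n)}
  {k : Matrix (Fin n) (Fin m) ℝ} {r μ : ℝ} {l q : ℕ}

theorem closedLoopEstimate_of_forall_le (hr : 0 ≤ r) (hfc : Continuous fun p : _ × _ => f p.1 p.2)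
    (hfl : LipOnBounded f) {L : ℝ} (hL : 0 ≤ L) (hgrowth : ∀ x u, ‖f x u‖ ≤ L * ‖x‖ + L * ‖u‖)
    (hμ : 0 ≤ μ) (hq : 0 < q) {σ : ℝ → ℝ → ℝ}
    (h : ∀ x₀ u₀ x u, IsClosedLoopSolution f k r μ l q (Ici 0) x₀ u₀ x u →
      ∀ t, 0 ≤ t → ‖x t‖ + ‖u t‖ ≤ σ (‖x₀‖ + ‖u₀‖) t) :
    ClosedLoopEstimate f k r μ l q σ := by
  intro x₀ u₀
  obtain ⟨x, u, hxu⟩ := exists_isClosedLoopSolution hr hfc hfl hL hgrowth k hμ l hq x₀ u₀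
  exact ⟨x, u, hxu, fun b y w _ hyw =>
    IsClosedLoopSolution.eqOn hr hfc hfl hL hgrowth hμ hq hyw (hxu.mono Ico_subset_Ici_self),
    h x₀ u₀ x u hxu⟩

theorem exists_forall_mul_pow_le {ρ : ℝ} (hρ0 : 0 ≤ ρ) (hρ1 : ρ < 1) (P : ℝ) {ε : ℝ} (hε : 0 < ε) :
    ∃ l₀ : ℕ, 1 ≤ l₀ ∧ ∀ l, l₀ ≤ l → P * ρ ^ l ≤ ε := by
  have h := (tendsto_pow_atTop_nhds_zero_of_lt_one hρ0 hρ1).const_mul P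
  rw [mul_zero] at h
  obtain ⟨N, hN⟩ := eventually_atTop.1 (h.eventually_le_const hε)
  exact ⟨max N 1, le_max_right _ _, fun l hl => hN l ((le_max_left _ _).trans hl)⟩

theorem norm_add_norm_le_of_deviation {x : ℝ → EuclideanSpace ℝ (Fin n)}
    {u : ℝ → EuclideanSpace ℝ (Fin m)} {t Z : ℝ} (h1 : ‖x t‖ ≤ Z) (h2 : ‖x (t + r)‖ ≤ Z)
    (h3 : ‖deviation k r x u t‖ ≤ Z) : ‖x t‖ + ‖u t‖ ≤ (2 + ‖feedbackCLM k‖) * Z := by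
  have h4 : ‖u t‖ ≤ ‖deviation k r x u t‖ + ‖feedbackCLM k (x (t + r))‖ := by
    have := norm_add_le (deviation k r x u t) (feedbackCLM k (x (t + r)))
    rwa [deviation, sub_add_cancel] at this
  have h5 := ((feedbackCLM k).le_opNorm (x (t + r))).trans
    (mul_le_mul_of_nonneg_left h2 (norm_nonneg _))
  linarith

theorem exists_closedLoopEstimate_of_issLinearGain
    (hf : LocallyLipschitz
      (fun p : EuclideanSpace ℝ (Fin n) × EuclideanSpace ℝ (Fin m) => f p.1 p.2))
    {L : ℝ} (hL : 0 ≤ L) (hLip : ∀ x y u, ‖f x u - f y u‖ ≤ L * ‖x - y‖)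
    (hgrowth : ∀ x u, ‖f x u‖ ≤ L * ‖x‖ + L * ‖u‖) (hr : 0 ≤ r) (hq : 0 < q) (hLrq : L * r < q)
    (hμ : 0 < μ) (hISS : ISSLinearGain f k) :
    ∃ l₀ : ℕ, 1 ≤ l₀ ∧ ∀ l : ℕ, l₀ ≤ l →
      ∃ σ : ℝ → ℝ → ℝ, IsKL σ ∧ ClosedLoopEstimate f k r μ l q σ := by
  obtain ⟨σ, hσ, γ, hγ, hISS⟩ := hISS
  have hfc := hf.continuous
  have hfl := lipOnBounded_of_locallyLipschitz hf
  obtain ⟨c₀, hc₀, hinit⟩ := exists_initial_bound hL hgrowth k hr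
  obtain ⟨c, hc, herr⟩ := exists_norm_predictor_sub_solution_le hfc hL hLip hr hq hLrq
  have hq' : (0 : ℝ) < q := by positivity
  have hρ0 : 0 ≤ L * (r / q) := by positivity
  have hρ1 : L * (r / q) < 1 := by rw [← mul_div_assoc, div_lt_one hq']; exact hLrq
  set F := ‖feedbackCLM k‖ with hF
  have hF0 : 0 ≤ F := norm_nonneg _
  -- The threshold depends only on `γ`, `μ`, `L`, the norm of the feedback and the error constant
  -- `c`, never on initial data.
  obtain ⟨l₀, hl₀, hsmall⟩ := exists_forall_mul_pow_le hρ0 hρ1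
    ((1 + γ) * (F * (L + μ) * c / μ)) (show (0 : ℝ) < 1 / 4 by norm_num)
  refine ⟨l₀, hl₀, fun l hl => ?_⟩
  set κ := F * (L + μ) * (c * (L * (r / q)) ^ l) / μ with hκ
  have hκ0 : 0 ≤ κ := by positivity
  have hκs : (1 + γ) * κ ≤ 1 / 4 := (le_of_eq (by rw [hκ]; ring)).trans (hsmall l hl)
  have hinter : ∀ x₀ u₀ x u, IsClosedLoopSolution f k r μ l q (Ici 0) x₀ u₀ x u →
      IsInterconnection σ γ μ κ r (fun t => ‖x t‖) (fun t => ‖deviation k r x u t‖) := by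
    intro x₀ u₀ x u h
    refine ⟨fun t => norm_nonneg _, fun a t B ha hat hB => ?_, fun a t S ha hat hS => ?_⟩
    · have := hISS _ _ _ (h.isInput_deviation hr ha) (h.isPerturbedSolution hfc hr ha) (t - a)
        (sub_nonneg.2 hat) B fun τ hτ => hB _ ⟨by linarith [hτ.1], by linarith [hτ.2]⟩
      rwa [show a + r + (t - a) = t + r by ring] at this
    · have := h.exp_mul_norm_deviation_le hL hLip hr (by positivity) (herr h) le_rfl hμ ha hat
        (S := S) fun τ hτ => by simpa using hS τ hτ
      simpa using this
  -- The small-gain bound with `lam = 0`, `N = c₀ s` and `a = σ(c₀ s, 0)`. It inherits continuity,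
  -- strict growth and the zero at the origin from `σ(·, 0)`.
  set Z : ℝ → ℝ := fun s => 2 * (σ (c₀ * s) 0 + (1 + γ) * (c₀ * s)) with hZ
  have hc₀' : 0 < c₀ := by linarith
  have hZm : StrictMonoOn Z (Ici 0) := fun s hs s' hs' hss => by
    have h1 : c₀ * s < c₀ * s' := mul_lt_mul_of_pos_left hss hc₀'
    have h2 : σ (c₀ * s) 0 < σ (c₀ * s') 0 := hσ.strictMono 0 le_rfl
      (mul_nonneg hc₀'.le hs) (mul_nonneg hc₀'.le hs') h1
    have h3 := mul_lt_mul_of_pos_left h1 (show 0 < 1 + γ by positivity)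
    simp only [hZ]
    linarith
  have hZc : ContinuousOn Z (Ici 0) := by
    have : ContinuousOn (fun s => σ (c₀ * s) 0) (Ici 0) :=
      hσ.continuousOn.comp (f := fun s : ℝ => (c₀ * s, (0 : ℝ))) (by fun_prop)
        fun s hs => ⟨mul_nonneg hc₀'.le hs, mem_Ici.2 le_rfl⟩
    exact continuousOn_const.mul (this.add (by fun_prop))
  have hZ0 : Z 0 = 0 := by simp [hZ, hσ.zero 0 le_rfl]
  have hbd : ∀ x₀ u₀ x u, IsClosedLoopSolution f k r μ l q (Ici 0) x₀ u₀ x u → ∀ t, 0 ≤ t →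
      ‖x t‖ ≤ Z (‖x₀‖ + ‖u₀‖) ∧ ‖deviation k r x u t‖ ≤ Z (‖x₀‖ + ‖u₀‖) := by
    intro x₀ u₀ x u h t ht
    have hI := hinter x₀ u₀ x u h
    obtain ⟨hx, hw⟩ := hinit h
    have hs : 0 ≤ c₀ * (‖x₀‖ + ‖u₀‖) := by positivity
    have hxr := hx r ⟨hr, le_rfl⟩
    have h0σ : 0 ≤ σ (c₀ * (‖x₀‖ + ‖u₀‖)) 0 := (hσ.zero 0 le_rfl).ge.trans
      ((hσ.strictMono 0 le_rfl).monotoneOn (mem_Ici.2 le_rfl) hs hs)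
    have := smallGain_le (X := fun t => ‖x t‖) (W := fun t => ‖deviation k r x u t‖) (lam := 0)
      (N := c₀ * (‖x₀‖ + ‖u₀‖)) (a := σ (c₀ * (‖x₀‖ + ‖u₀‖)) 0) (κ := κ) (γ := γ)
      h.continuousOn_fst.norm hr le_rfl hs h0σ hκ0 hγ hI.fst_nonneg hx
      (fun t B ht hB => by
        have h1 := hI.fst_le 0 t B le_rfl ht fun τ hτ => by simpa using hB τ hτ
        simp only [zero_add, sub_zero] at h1
        simp only [zero_mul, Real.exp_zero, one_mul]
        refine h1.trans (max_le_max_right _ ?_)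
        exact (hσ.antitone _ (norm_nonneg _) (mem_Ici.2 le_rfl) ht ht).trans
          ((hσ.strictMono 0 le_rfl).monotoneOn (norm_nonneg (x r)) hs hxr))
      (fun t S ht hS => by
        have h1 := hI.snd_le 0 t S le_rfl ht fun τ hτ => by simpa using hS τ hτ
        simp only [zero_mul, Real.exp_zero, one_mul]
        have h2 : ‖deviation k r x u 0‖ ≤ c₀ * (‖x₀‖ + ‖u₀‖) := by
          rwa [deviation, zero_add]
        have h3 : Real.exp (-μ * (t - 0)) ≤ 1 := Real.exp_le_one_iff.2 (by nlinarith)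
        have h4 := mul_le_of_le_one_left (norm_nonneg (deviation k r x u 0)) h3
        linarith)
      (by simpa using hκs) ht
    simpa [hZ] using this
  -- The index set consists of all global solutions together with their initial data, so that one
  -- `KL` function serves them all.
  obtain ⟨σ', hσ', hle⟩ := exists_isKL_majorant
    (ι := {p : (EuclideanSpace ℝ (Fin n) × C(Icc (-r) 0, EuclideanSpace ℝ (Fin m))) ×
      (ℝ → EuclideanSpace ℝ (Fin n)) × (ℝ → EuclideanSpace ℝ (Fin m)) //
      IsClosedLoopSolution f k r μ l q (Ici 0) p.1.1 p.1.2 p.2.1 p.2.2})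
    (N := fun p => ‖p.1.1.1‖ + ‖p.1.1.2‖) (V := fun p t => ‖p.1.2.1 t‖ + ‖p.1.2.2 t‖)
    (α := fun s => (2 + F) * Z s) (continuousOn_const.mul hZc)
    (fun s hs s' hs' hss => mul_lt_mul_of_pos_left (hZm hs hs' hss) (by positivity))
    (by simp [hZ0]) (fun p => by positivity) (fun p t => by positivity)
    (fun ⟨⟨⟨x₀, u₀⟩, x, u⟩, h⟩ t ht => norm_add_norm_le_of_deviation
      (hbd x₀ u₀ x u h t ht).1 (hbd x₀ u₀ x u h (t + r) (add_nonneg ht hr)).1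
      (hbd x₀ u₀ x u h t ht).2)
    (fun R η hη => by
      have hR : (0 : ℝ) ≤ max R 0 := le_max_right _ _
      have hZR : 0 ≤ Z (max R 0) := hZ0.ge.trans (hZm.monotoneOn (mem_Ici.2 le_rfl) hR hR)
      -- Adding `1` makes the common bound positive even if it vanishes. Dividing `η` by `2 + F`
      -- compensates the passage from `x` and the deviation to `|x| + |u|`.
      obtain ⟨T, hT, hTX⟩ := exists_attraction_time hσ hγ hμ hr hκs
        (show 0 < Z (max R 0) + 1 by positivity) (show 0 < η / (2 + F) by positivity)
      refine ⟨T, fun ⟨⟨⟨x₀, u₀⟩, x, u⟩, h⟩ hN t ht => ?_⟩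
      have hN' : ‖x₀‖ + ‖u₀‖ ≤ max R 0 := le_trans hN (le_max_left _ _)
      have hZN : Z (‖x₀‖ + ‖u₀‖) ≤ Z (max R 0) :=
        hZm.monotoneOn (mem_Ici.2 (by positivity)) hR hN'
      have := hTX _ _ (hinter x₀ u₀ x u h) fun t ht =>
        ⟨(hbd x₀ u₀ x u h t ht).1.trans (by linarith), (hbd x₀ u₀ x u h t ht).2.trans (by linarith)⟩
      have h1 := norm_add_norm_le_of_deviation (this t ht).1 (this (t + r) (by linarith)).1
        (this t ht).2
      rwa [mul_div_cancel₀ _ (by positivity)] at h1)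
  exact ⟨σ', hσ', closedLoopEstimate_of_forall_le hr hfc hfl hL hgrowth hμ.le hq
    fun x₀ u₀ x u h t ht => hle ⟨((x₀, u₀), x, u), h⟩ t ht⟩

theorem exists_closedLoopEstimate_of_issExponential
    (hf : LocallyLipschitz
      (fun p : EuclideanSpace ℝ (Fin n) × EuclideanSpace ℝ (Fin m) => f p.1 p.2))
    {L : ℝ} (hL : 0 ≤ L) (hLip : ∀ x y u, ‖f x u - f y u‖ ≤ L * ‖x - y‖)
    (hgrowth : ∀ x u, ‖f x u‖ ≤ L * ‖x‖ + L * ‖u‖) (hr : 0 ≤ r) (hq : 0 < q) (hLrq : L * r < q)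
    (hμ : 0 < μ) (hISS : ISSExponential f k) :
    ∃ l₀ : ℕ, 1 ≤ l₀ ∧ ∀ l : ℕ, l₀ ≤ l → ∃ M ω : ℝ, 0 < M ∧ 0 < ω ∧
      ClosedLoopEstimate f k r μ l q (fun s t => M * Real.exp (-ω * t) * s) := by
  obtain ⟨M, ω, γ, hM, hω, hγ, hISS⟩ := hISS
  have hfc := hf.continuous
  have hfl := lipOnBounded_of_locallyLipschitz hf
  obtain ⟨c₀, hc₀, hinit⟩ := exists_initial_bound hL hgrowth k hr
  obtain ⟨c, hc, herr⟩ := exists_norm_predictor_sub_solution_le hfc hL hLip hr hq hLrq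
  have hq' : (0 : ℝ) < q := by positivity
  have hρ0 : 0 ≤ L * (r / q) := by positivity
  have hρ1 : L * (r / q) < 1 := by rw [← mul_div_assoc, div_lt_one hq']; exact hLrq
  set F := ‖feedbackCLM k‖ with hF
  have hF0 : 0 ≤ F := norm_nonneg _
  -- Not above `ω`, so that the weighted hypothesis survives multiplication by `exp(lam t)`;
  -- strictly below `μ`, so that the deviation still decays in the weighted norm.
  set lam := min ω (μ / 2) with hlam
  have hlam0 : 0 < lam := lt_min hω (by positivity)
  have hlamμ : lam < μ := (min_le_right _ _).trans_lt (half_lt_self hμ)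
  have hlamω : lam ≤ ω := min_le_left _ _
  have hμl : 0 < μ - lam := sub_pos.2 hlamμ
  set e := Real.exp (lam * r) with he
  have he0 : 0 < e := Real.exp_pos _
  -- The factor `exp(lam r)` is the price of shifting the weight by the delay in the small-gain
  -- argument.
  obtain ⟨l₀, hl₀, hsmall⟩ := exists_forall_mul_pow_le hρ0 hρ1
    (e * ((1 + γ) * (F * (L + μ) * c / (μ - lam)))) (show (0 : ℝ) < 1 / 4 by norm_num)
  refine ⟨l₀, hl₀, fun l hl => ?_⟩
  set κ := F * (L + μ) * (c * (L * (r / q)) ^ l) / (μ - lam) with hκ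
  have hκ0 : 0 ≤ κ := by positivity
  have hκs : e * ((1 + γ) * κ) ≤ 1 / 4 := (le_of_eq (by rw [hκ]; ring)).trans (hsmall l hl)
  set Z := 2 * e * (M * c₀ + (1 + γ) * c₀) with hZ
  have hZ0 : 0 < Z := by positivity
  refine ⟨(2 + F) * Z, lam, by positivity, hlam0, closedLoopEstimate_of_forall_le hr hfc hfl hL
    hgrowth hμ.le hq fun x₀ u₀ x u h t ht => ?_⟩
  obtain ⟨hx, hw⟩ := hinit h
  have hs : 0 ≤ c₀ * (‖x₀‖ + ‖u₀‖) := by positivity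
  have hxr := hx r ⟨hr, le_rfl⟩
  have hbd : ∀ t, 0 ≤ t → ‖x t‖ ≤ Z * Real.exp (-lam * t) * (‖x₀‖ + ‖u₀‖) ∧
      ‖deviation k r x u t‖ ≤ Z * Real.exp (-lam * t) * (‖x₀‖ + ‖u₀‖) := by
    intro t ht
    have key := smallGain_le (X := fun t => ‖x t‖) (W := fun t => ‖deviation k r x u t‖)
      (lam := lam) (N := c₀ * (‖x₀‖ + ‖u₀‖)) (a := M * (c₀ * (‖x₀‖ + ‖u₀‖))) (κ := κ) (γ := γ)
      h.continuousOn_fst.norm hr hlam0.le hs (by positivity) hκ0 hγ (fun t => norm_nonneg _) hx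
      (fun t B ht hB => by
        have h1 := hISS _ _ _ (h.isInput_deviation hr le_rfl) (h.isPerturbedSolution hfc hr le_rfl)
          t ht (Real.exp (-lam * t) * B) fun τ hτ => by
            -- As `lam ≤ ω` and `τ ≤ t`, the fading memory at rate `ω` is dominated by the one at
            -- rate `lam`, so a bound on the weighted deviation is admissible in the hypothesis.
            have h2 : Real.exp (-ω * (t - τ)) ≤ Real.exp (-lam * t) * Real.exp (lam * τ) := by
              rw [← Real.exp_add]
              exact Real.exp_le_exp.2 (by nlinarith [hτ.2])
            have h3 := mul_le_mul_of_nonneg_right h2 (norm_nonneg (deviation k r x u (0 + τ)))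
            have h4 := mul_le_mul_of_nonneg_left (hB τ hτ) (Real.exp_pos (-lam * t)).le
            rw [zero_add] at h3 ⊢
            linarith
        simp only [zero_add] at h1
        rw [add_comm r t] at h1
        have h5 : Real.exp (lam * t) * Real.exp (-lam * t) = 1 := by
          rw [← Real.exp_add]
          simp
        have h6 : Real.exp (lam * t) * Real.exp (-ω * t) ≤ 1 := by
          rw [← Real.exp_add]
          exact Real.exp_le_one_iff.2 (by nlinarith)
        refine (mul_le_mul_of_nonneg_left h1 (Real.exp_pos _).le).trans ?_
        rw [mul_max_of_nonneg _ _ (Real.exp_pos _).le]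
        refine max_le_max ?_ (le_of_eq ?_)
        · calc Real.exp (lam * t) * (M * Real.exp (-ω * t) * ‖x r‖) =
              (Real.exp (lam * t) * Real.exp (-ω * t)) * (M * ‖x r‖) := by ring
            _ ≤ 1 * (M * ‖x r‖) := mul_le_mul_of_nonneg_right h6 (by positivity)
            _ ≤ M * (c₀ * (‖x₀‖ + ‖u₀‖)) := by
              rw [one_mul]
              exact mul_le_mul_of_nonneg_left hxr hM.le
        · calc Real.exp (lam * t) * (γ * (Real.exp (-lam * t) * B)) =
              γ * B * (Real.exp (lam * t) * Real.exp (-lam * t)) := by ring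
            _ = γ * B := by rw [h5, mul_one])
      (fun t S ht hS => by
        have h1 := h.exp_mul_norm_deviation_le hL hLip hr (by positivity) (herr h) hlam0.le hlamμ
          le_rfl ht hS
        have h2 : ‖deviation k r x u 0‖ ≤ c₀ * (‖x₀‖ + ‖u₀‖) := by
          rwa [deviation, zero_add]
        have h3 : Real.exp (-(μ - lam) * (t - 0)) ≤ 1 := Real.exp_le_one_iff.2 (by nlinarith)
        have h4 := mul_le_of_le_one_left (norm_nonneg (deviation k r x u 0)) h3
        rw [mul_zero, Real.exp_zero, one_mul] at h1
        linarith)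
      hκs ht
    have h7 : 2 * e * (M * (c₀ * (‖x₀‖ + ‖u₀‖)) + (1 + γ) * (c₀ * (‖x₀‖ + ‖u₀‖))) =
        Z * (‖x₀‖ + ‖u₀‖) := by rw [hZ]; ring
    rw [h7] at key
    have hle : ∀ y : ℝ, Real.exp (lam * t) * y ≤ Z * (‖x₀‖ + ‖u₀‖) →
        y ≤ Z * Real.exp (-lam * t) * (‖x₀‖ + ‖u₀‖) := fun y hy => by
      rw [neg_mul, Real.exp_neg, mul_right_comm, ← div_eq_mul_inv, le_div_iff₀ (Real.exp_pos _),
        mul_comm]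
      exact hy
    exact ⟨hle _ key.1, hle _ key.2⟩
  have hmono : Z * Real.exp (-lam * (t + r)) * (‖x₀‖ + ‖u₀‖) ≤
      Z * Real.exp (-lam * t) * (‖x₀‖ + ‖u₀‖) := by
    refine mul_le_mul_of_nonneg_right (mul_le_mul_of_nonneg_left ?_ hZ0.le) (by positivity)
    exact Real.exp_le_exp.2 (by nlinarith)
  refine (norm_add_norm_le_of_deviation (hbd t ht).1
    ((hbd (t + r) (add_nonneg ht hr)).1.trans hmono) (hbd t ht).2).trans (le_of_eq ?_)
  simp only [hF]
  ring

end Stability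

end DelayPredictor

theorem corollary3p6 {n m : ℕ}
    (f : EuclideanSpace ℝ (Fin n) → EuclideanSpace ℝ (Fin m) → EuclideanSpace ℝ (Fin n))
    (hf : LocallyLipschitz
      (fun p : EuclideanSpace ℝ (Fin n) × EuclideanSpace ℝ (Fin m) => f p.1 p.2))
    (L : ℝ) (hL : 0 ≤ L)
    (hLip : ∀ x y u, ‖f x u - f y u‖ ≤ L * ‖x - y‖)
    (hgrowth : ∀ x u, ‖f x u‖ ≤ L * ‖x‖ + L * ‖u‖)
    (k : Matrix (Fin n) (Fin m) ℝ)
    (r : ℝ) (hr : 0 ≤ r)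
    (q : ℕ) (hq : 0 < q) (hLrq : L * r < q)
    (μ : ℝ) (hμ : 0 < μ) :
    (DelayPredictor.ISSLinearGain f k →
      ∃ l₀ : ℕ, 1 ≤ l₀ ∧ ∀ l : ℕ, l₀ ≤ l →
        ∃ σ : ℝ → ℝ → ℝ, DelayPredictor.IsKL σ ∧
          DelayPredictor.ClosedLoopEstimate f k r μ l q σ) ∧
    (DelayPredictor.ISSExponential f k →
      ∃ l₀ : ℕ, 1 ≤ l₀ ∧ ∀ l : ℕ, l₀ ≤ l →
        ∃ M ω : ℝ, 0 < M ∧ 0 < ω ∧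
          DelayPredictor.ClosedLoopEstimate f k r μ l q
            (fun s t => M * Real.exp (-ω * t) * s)) :=
  ⟨DelayPredictor.exists_closedLoopEstimate_of_issLinearGain hf hL hLip hgrowth hr hq hLrq hμ,
    DelayPredictor.exists_closedLoopEstimate_of_issExponential hf hL hLip hgrowth hr hq hLrq hμ⟩
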